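/- Let $N,p\ge 1$ and let $(\omega_1,Y_1),\dots,(\omega_N,Y_N)$ be independent random pairs taking values in $\Omega\times\mathcal Y$. Suppose that for each $i$ there are ($s$-finite, e.g. $\sigma$-finite) measures $\mu_i$ on $\Omega$ and $\nu_i$ on $\mathcal Y$ and (measurable) functions $g_i:\mathbb R\to\mathbb R$, $k_i:\Omega\times\mathcal Y\to[0,\infty)$, $x_i=(x_{i1},\dots,x_{ip}):\Omega\to\mathbb R^p$ such that $(\omega_i,Y_i)$ has, with respect to $\mu_i\times\nu_i$, the density $$\frac{g_i(x_i(z)^\top\theta)\,k_i(z,y)}{Z_i(\theta)},\qquad Z_i(u)=\int g_i(x_i(z)^\top u)\,k_i(z,y)\,\mu_i(dz)\,\nu_i(dy),$$ where $\theta\in\mathbb R^p$ is the true parameter. Only $Y_1,\dots,Y_N$ are observed, and the negative log-likelihood is $$\ell(u)=-\sum_{i=1}^N\ln\int g_i(x_i(z)^\top u)\,k_i(z,Y_i)\,\mu_i(dz)+\sum_{i=1}^N\ln Z_i(u).$$ Let $D\subset\mathbb R^p$ be a bounded set with $\theta\in D$. Assume that there is $M_X>0$ such that almost surely $\|x_i(\omega_i)\|_\infty\le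 M_X$ for all $i\le N$, that every $g_i$ is differentiable, and that there are $0<A_g<B_g<\infty$ and $F_1,F_2<\infty$ with $$A_g\le g_i(t)\le B_g,\qquad |g_i'(t)|\le F_1,\qquad |g_i'(t)-g_i'(s)|\le F_2|t-s|\qquad\text{for all } s,t\in\mathbb R,\ i\le N.$$ Put $R_D=\sup_{u\in D}\|u-\theta\|_1$, $I_g=[A_g/B_g,B_g/A_g]$, $\varrho(z)=z^{-1}\ln(1+z)-1$ for $z\in(-1,\infty)\setminus\{0\}$, $\varrho(0)=0$, $\varrho_0=\sup_{t\in I_g}|\varrho(t-1)|$, $\varrho_1=\sup_{t\in I_g}|\varrho'(t-1)|$, and $$\psi_1=\frac{F_1}{A_g},\quad \psi_2=\frac{F_2M_X}{2A_g},\quad \psi_3=\frac{\min(2F_1,\,F_2M_XR_D/2)}{A_g},$$ $$\psi_4=[\psi_1\varrho_0+\psi_3(1+\varrho_0)]M_X,\quad \psi_5=2\psi_1M_X\varrho_1,\quad \psi_6=2(\varrho_0+\psi_3M_X\varrho_1),$$ $$A=2\psi_2(1+\psi_6)+(\psi_1+2\psi_2R_D+2\psi_3)(\psi_5+\psi_6),\qquad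 S_X=\max_{1\le j\le p}\sqrt{\sum_{i=1}^N x_{ij}(\omega_i)^2}.$$ Write $\overline{\xi}=\xi-\mathbb E\,\xi$. Then $\ell(u)-\ell(\theta)$ $(u\in D)$ and $S_X$ are integrable, and for any $q_0,q_1\in(0,1)$ with $q_0+q_1<1$, with probability at least $1-q_0-q_1$, $$\sup_{u\in D\setminus\{\theta\}}\frac{\bigl|\overline{\ell(u)-\ell(\theta)}\bigr|}{\|u-\theta\|_1}\le 2\sqrt2\,R_D\,\mathbb E S_X\Bigl(A\sqrt{\ln(2p)}+2\psi_3(\psi_5+\psi_6)\Bigr)+\sqrt{2N}\Bigl(\psi_1M_X\sqrt{\ln(2p/q_0)}+2\psi_4\sqrt{\ln(p/q_1)}\Bigr).$$ -/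

import Mathlib

open MeasureTheory ProbabilityTheory Set
open scoped ENNReal

noncomputable section

namespace HiddenCovariate

/-- The `ℓ₁` norm on `ℝᵖ`. -/
def l1norm {p : ℕ} (v : Fin p → ℝ) : ℝ := ∑ j, |v j|

/-- `R_D = sup_{u ∈ D} ‖u - θ‖₁`. -/
def radius {p : ℕ} (D : Set (Fin p → ℝ)) (θ : Fin p → ℝ) : ℝ :=
  sSup ((fun u => l1norm (u - θ)) '' D)

section Model

variable {W 𝒴 : Type*} [MeasurableSpace W] [MeasurableSpace 𝒴] {p : ℕ}

/-- The normalizing constant `Z(u) = ∫ g(x(z)ᵀu) k(z,y) μ(dz) ν(dy)`. -/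
def normConst (μ : Measure W) (ν : Measure 𝒴) (g : ℝ → ℝ) (k : W → 𝒴 → ℝ)
    (x : W → Fin p → ℝ) (u : Fin p → ℝ) : ℝ :=
  ∫ s : W × 𝒴, g (x s.1 ⬝ᵥ u) * k s.1 s.2 ∂(μ.prod ν)

/-- The joint density `g(x(z)ᵀθ) k(z,y) / Z(θ)` of a pair (hidden variable, observation). -/
def jointDensity (μ : Measure W) (ν : Measure 𝒴) (g : ℝ → ℝ) (k : W → 𝒴 → ℝ)
    (x : W → Fin p → ℝ) (θ : Fin p → ℝ) (s : W × 𝒴) : ℝ :=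
  g (x s.1 ⬝ᵥ θ) * k s.1 s.2 / normConst μ ν g k x θ

/-- The negative log-likelihood based on the observations `y₁, …, y_N` only:
`ℓ(u) = -∑ᵢ ln ∫ gᵢ(xᵢ(z)ᵀu) kᵢ(z,yᵢ) μᵢ(dz) + ∑ᵢ ln Zᵢ(u)`. -/
def negLogLik {N : ℕ} (μ : Fin N → Measure W) (ν : Fin N → Measure 𝒴) (g : Fin N → ℝ → ℝ)
    (k : Fin N → W → 𝒴 → ℝ) (x : Fin N → W → Fin p → ℝ) (u : Fin p → ℝ) (y : Fin N → 𝒴) : ℝ :=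
  -∑ i, Real.log (∫ z, g i (x i z ⬝ᵥ u) * k i z (y i) ∂(μ i))
    + ∑ i, Real.log (normConst (μ i) (ν i) (g i) (k i) (x i) u)

/-- `S_X = max_j √(∑ᵢ X_{ij}²)` for covariate vectors `X₁, …, X_N ∈ ℝᵖ`. -/
def maxColNorm {N : ℕ} (X : Fin N → Fin p → ℝ) : ℝ :=
  ⨆ j, Real.sqrt (∑ i, X i j ^ 2)

end Model

/-- `ϱ(z) = z⁻¹ ln(1+z) - 1` for `z ≠ 0` and `ϱ(0) = 0`. -/
def rho (z : ℝ) : ℝ := if z = 0 then 0 else z⁻¹ * Real.log (1 + z) - 1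

/-- `ϱ₀ = sup_{t ∈ I_g} |ϱ(t-1)|`, where `I_g = [A_g/B_g, B_g/A_g]`. -/
def rho0 (Ag Bg : ℝ) : ℝ := sSup ((fun t => |rho (t - 1)|) '' Icc (Ag / Bg) (Bg / Ag))

/-- `ϱ₁ = sup_{t ∈ I_g} |ϱ'(t-1)|`, where `I_g = [A_g/B_g, B_g/A_g]`. -/
def rho1 (Ag Bg : ℝ) : ℝ := sSup ((fun t => |deriv rho (t - 1)|) '' Icc (Ag / Bg) (Bg / Ag))

/-- `ψ₁ = F₁/A_g`. -/
def psi1 (Ag F1 : ℝ) : ℝ := F1 / Ag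

/-- `ψ₂ = F₂ M_X/(2 A_g)`. -/
def psi2 (Ag F2 MX : ℝ) : ℝ := F2 * MX / (2 * Ag)

/-- `ψ₃ = min(2F₁, F₂ M_X R_D/2)/A_g`. -/
def psi3 (Ag F1 F2 MX R : ℝ) : ℝ := min (2 * F1) (F2 * MX * R / 2) / Ag

/-- `ψ₄ = [ψ₁ ϱ₀ + ψ₃ (1+ϱ₀)] M_X`. -/
def psi4 (Ag Bg F1 F2 MX R : ℝ) : ℝ :=
  (psi1 Ag F1 * rho0 Ag Bg + psi3 Ag F1 F2 MX R * (1 + rho0 Ag Bg)) * MX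

/-- `ψ₅ = 2 ψ₁ M_X ϱ₁`. -/
def psi5 (Ag Bg F1 MX : ℝ) : ℝ := 2 * psi1 Ag F1 * MX * rho1 Ag Bg

/-- `ψ₆ = 2 (ϱ₀ + ψ₃ M_X ϱ₁)`. -/
def psi6 (Ag Bg F1 F2 MX R : ℝ) : ℝ :=
  2 * (rho0 Ag Bg + psi3 Ag F1 F2 MX R * MX * rho1 Ag Bg)

/-- `A = 2ψ₂(1+ψ₆) + (ψ₁ + 2ψ₂R_D + 2ψ₃)(ψ₅+ψ₆)`. -/
def coeffA (Ag Bg F1 F2 MX R : ℝ) : ℝ :=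
  2 * psi2 Ag F2 MX * (1 + psi6 Ag Bg F1 F2 MX R)
    + (psi1 Ag F1 + 2 * psi2 Ag F2 MX * R + 2 * psi3 Ag F1 F2 MX R)
      * (psi5 Ag Bg F1 MX + psi6 Ag Bg F1 F2 MX R)

end HiddenCovariate

end

/-!
The difference `ℓ(u) - ℓ(θ)` is, up to a constant, `-∑ᵢ ln 𝔼[gᵢ(xᵢᵀu) / gᵢ(xᵢᵀθ) | Yᵢ]`: the common
factor of numerator and denominator turns the likelihood integral into a posterior mean of a density
ratio (`exists_posterior`). Put `δ = u - θ` and write this posterior mean as `1 + v`. The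
fundamental theorem of calculus gives `v = ∑ⱼ δⱼ (aⱼ + wⱼ)`, where `aⱼ` is the posterior score,
which does not depend on `u`, and `wⱼ` is small for small `δ`. As `ln (1 + v) = v (1 + ϱ(v))`, the
log-ratio is `∑ⱼ δⱼ (aⱼ + Fⱼ)` with the remainders `Fⱼ = wⱼ + (aⱼ + wⱼ) ϱ(v)`
(`log_one_add_condRatio`), and by duality of the `ℓ₁` and the `ℓ_∞` norm it suffices to bound, for
each coordinate `j`, the centred sums of the `aⱼ` and, uniformly in `u`, those of the `Fⱼ`.

The sums of the `aⱼ` are handled by Hoeffding's inequality (`measureReal_score_le`). For the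
remainders, McDiarmid's inequality bounds the deviation of the supremum over `u` from its mean
(`hasSubgaussianMGF_of_bounded_differences`). By symmetrization
(`integral_supT_sum_sub_integral_le`) the mean is at most a Rademacher average. Contraction
principles remove `ϱ`, and also the product `wⱼ ϱ(v)` (`rad_le_of_abs_sub_le`,
`rad_le_of_abs_sub_le_add`). What remains are Rademacher averages of the posterior means `wⱼ` and
`v`. Jensen's inequality replaces the posterior means by functions of the hidden variables
themselves (`rad_integral_kernel_le`), and a further contraction replaces these by linear functions
of the covariates, for which the Rademacher average is at most `√(2 ln (2p)) R_D 𝔼 S_X`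
(`rad_dotProduct_le`). All these comparisons exchange the independent summands one at a time;
`integral_le_integral_of_forall_supLike` does this once for all of them.

Suprema are taken over finite subsets of `D`. The bound extends to a countable dense subset by
monotone continuity of the measure and to `D` by continuity in `u`
(`exists_forall_abs_centredLog_le`), so that no measurability of an uncountable supremum is needed.
The covariates, bounded only almost surely, are truncated to be bounded everywhere.
-/

open scoped NNReal

namespace HiddenCovariate

/-! ### Functionals of finite processes that behave like a supremum -/

section Functionals

variable {S T : Type*} [MeasurableSpace S]

/-- A random function on the index set `T`, given as a function of a random point `s : S`, that is
measurable in `s` and bounded uniformly in `s` and `t`. -/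
structure BddMeas (F : S → T → ℝ) : Prop where
  meas : Measurable F
  bdd : ∃ C, ∀ s t, |F s t| ≤ C

variable [Fintype T]

theorem BddMeas.exists_norm_le {F : S → T → ℝ} (hF : BddMeas F) :
    ∃ C, 0 ≤ C ∧ ∀ s, ‖F s‖ ≤ C := by
  obtain ⟨C, hC⟩ := hF.bdd
  refine ⟨|C|, abs_nonneg _, fun s => (pi_norm_le_iff_of_nonneg (abs_nonneg _)).2 fun t => ?_⟩
  exact (hC s t).trans (le_abs_self _)

/-- The properties of `A ↦ sup_t A t` on which symmetrization and contraction rest. They are kept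
when `Φ` is averaged over independent random shifts (`SupLike.mix`), which lets the summands of a
sum of independent processes be exchanged one at a time.

The field `contr` reads `𝔼 Φ(A + ε f) ≤ 𝔼 Φ(A + ε a + ε' b)` for independent random signs `ε`, `ε'`:
if the increments of `f` are dominated by those of `a` or `b`, whichever are larger, then replacing
`ε f` by `ε a + ε' b` does not decrease the mean. -/
structure SupLike (Φ : (T → ℝ) → ℝ) : Prop where
  lip : LipschitzWith 1 Φ
  convex : ConvexOn ℝ univ Φ
  contr : ∀ A f a b : T → ℝ, (∀ s t, |f s - f t| ≤ max |a s - a t| |b s - b t|) →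
    Φ (A + f) + Φ (A - f) ≤
      (Φ (A + (a + b)) + Φ (A - (a + b)) + Φ (A + (a - b)) + Φ (A - (a - b))) / 2

/-- The supremum of a real function; it is the maximum as soon as `T` is finite and nonempty. -/
noncomputable def supT (A : T → ℝ) : ℝ := ⨆ t, A t

theorem le_supT (A : T → ℝ) (t : T) : A t ≤ supT A := le_ciSup (Finite.bddAbove_range A) t

omit [Fintype T] in
theorem supT_le [Nonempty T] {A : T → ℝ} {c : ℝ} (h : ∀ t, A t ≤ c) : supT A ≤ c := ciSup_le h

theorem exists_supT [Nonempty T] (A : T → ℝ) : ∃ t, supT A = A t := by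
  obtain ⟨t, ht⟩ := exists_eq_ciSup_of_finite (f := A)
  exact ⟨t, ht.symm⟩

/-- For `contr`, let the two suprema on the left be attained at `s` and `t`. Their sum is `A s + A t
+ (f s - f t)`, and `f s - f t` is at most one of `±(a s - a t)`, `±(b s - b t)`. Evaluating two of
the four suprema on the right at `s` and the other two at `t`, the unwanted terms cancel. -/
theorem supLike_supT [Nonempty T] : SupLike (supT : (T → ℝ) → ℝ) where
  lip := by
    refine LipschitzWith.of_le_add fun A B => supT_le fun t => ?_
    have h1 := le_supT B t
    have h2 : A t - B t ≤ dist A B :=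
      (le_abs_self _).trans ((Real.dist_eq _ _).symm.le.trans (dist_le_pi_dist A B t))
    linarith
  convex := by
    refine ⟨convex_univ, fun A _ B _ a b ha hb _ => supT_le fun t => ?_⟩
    simp only [Pi.add_apply, Pi.smul_apply, smul_eq_mul]
    have := mul_le_mul_of_nonneg_left (le_supT A t) ha
    have := mul_le_mul_of_nonneg_left (le_supT B t) hb
    linarith
  contr := by
    intro A f a b h
    obtain ⟨s, hs⟩ := exists_supT (A + f)
    obtain ⟨t, ht⟩ := exists_supT (A - f)
    rw [hs, ht]
    have e1 := fun r => le_supT (A + (a + b)) r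
    have e2 := fun r => le_supT (A - (a + b)) r
    have e3 := fun r => le_supT (A + (a - b)) r
    have e4 := fun r => le_supT (A - (a - b)) r
    simp only [Pi.add_apply, Pi.sub_apply] at *
    have h1 := e1 s; have h2 := e1 t; have h3 := e2 s; have h4 := e2 t
    have h5 := e3 s; have h6 := e3 t; have h7 := e4 s; have h8 := e4 t
    have hf := (le_abs_self _).trans (h s t)
    rcases le_max_iff.1 hf with h' | h' <;> rcases le_abs.1 h' with h'' | h'' <;> linarith

namespace SupLike

variable {Φ : (T → ℝ) → ℝ}

theorem abs_le (h : SupLike Φ) (A : T → ℝ) : |Φ A| ≤ |Φ 0| + ‖A‖ := by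
  have := h.lip.dist_le_mul A 0
  rw [Real.dist_eq, dist_zero_right, NNReal.coe_one, one_mul] at this
  have := abs_sub_abs_le_abs_sub (Φ A) (Φ 0)
  linarith

theorem integrable (h : SupLike Φ) {F : S → T → ℝ} (hF : BddMeas F) (Q : Measure S)
    [IsFiniteMeasure Q] (A : T → ℝ) : Integrable (fun s => Φ (A + F s)) Q := by
  obtain ⟨C, _, hC⟩ := hF.exists_norm_le
  refine Integrable.of_bound (C := |Φ 0| + (‖A‖ + C)) ?_ (ae_of_all _ fun s => ?_)
  · exact (h.lip.continuous.measurable.comp (hF.meas.const_add A)).aestronglyMeasurable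
  · exact (h.abs_le _).trans (by gcongr; exact (norm_add_le _ _).trans (by gcongr; exact hC s))

/-- Averaging over an independent random shift preserves `SupLike`. -/
theorem mix (h : SupLike Φ) {F : S → T → ℝ} (hF : BddMeas F) (Q : Measure S)
    [IsProbabilityMeasure Q] : SupLike (fun A => ∫ s, Φ (A + F s) ∂Q) where
  lip := by
    refine LipschitzWith.of_le_add fun A B => ?_
    have : ∫ s, Φ (A + F s) ∂Q ≤ ∫ s, (Φ (B + F s) + dist A B) ∂Q := by
      refine integral_mono (h.integrable hF Q A)
        ((h.integrable hF Q B).add (integrable_const _)) fun s => ?_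
      have := h.lip.dist_le_mul (A + F s) (B + F s)
      rw [Real.dist_eq, NNReal.coe_one, one_mul, dist_add_right] at this
      have := le_abs_self (Φ (A + F s) - Φ (B + F s))
      simp only
      linarith
    rwa [integral_add (h.integrable hF Q B) (integrable_const _), integral_const,
      probReal_univ, one_smul] at this
  convex := by
    refine ⟨convex_univ, fun A _ B _ a b ha hb hab => ?_⟩
    simp only [smul_eq_mul]
    rw [← integral_const_mul, ← integral_const_mul, ← integral_add
      ((h.integrable hF Q A).const_mul _) ((h.integrable hF Q B).const_mul _)]
    refine integral_mono (h.integrable hF Q _) (((h.integrable hF Q A).const_mul _).add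
      ((h.integrable hF Q B).const_mul _)) fun s => ?_
    have := h.convex.2 (mem_univ (A + F s)) (mem_univ (B + F s)) ha hb hab
    have e : a • (A + F s) + b • (B + F s) = a • A + b • B + F s := by
      rw [smul_add, smul_add, add_add_add_comm, ← add_smul, hab, one_smul]
    rw [e] at this
    exact this
  contr := by
    intro A f a b hab
    have I := fun B => h.integrable hF Q B
    rw [← integral_add (I _) (I _), ← integral_add (I _) (I _), ← integral_add
      (f := fun s => Φ (_ + F s) + Φ (_ + F s)) ((I _).add (I _)) (I _), ← integral_add
      (f := fun s => Φ (_ + F s) + Φ (_ + F s) + Φ (_ + F s)) (((I _).add (I _)).add (I _)) (I _),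
      ← integral_div]
    refine integral_mono ((I _).add (I _)) (((((I _).add (I _)).add (I _)).add
      (I _)).div_const _) fun s => ?_
    have := h.contr (A + F s) f a b hab
    simp only [add_right_comm A _ (F s), ← add_sub_right_comm A (F s)]
    exact this

end SupLike

end Functionals

section Pi

variable {S : Type*} [MeasurableSpace S]

theorem integral_pi_succ {n : ℕ} (Q : Fin (n + 1) → Measure S) [∀ i, IsProbabilityMeasure (Q i)]
    {f : (Fin (n + 1) → S) → ℝ} (hf : Integrable f (Measure.pi Q)) :
    ∫ s, f s ∂Measure.pi Q =
      ∫ r, ∫ s, f (Fin.cons r s) ∂Measure.pi (fun i => Q i.succ) ∂Q 0 := by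
  have mp := (measurePreserving_piFinSuccAbove Q 0).symm
  have := mp.integral_comp' (g := f)
  rw [← this, integral_prod]
  · simp [MeasurableEquiv.piFinSuccAbove, Fin.consEquiv]
  · exact mp.integrable_comp_emb (MeasurableEquiv.measurableEmbedding _) |>.2 hf

end Pi

/-! ### Comparison of sums of independent processes -/

section Compare

variable {S S' T : Type*} [MeasurableSpace S] [MeasurableSpace S']

theorem BddMeas.sum {n : ℕ} {F : Fin n → S → T → ℝ} (hF : ∀ i, BddMeas (F i)) :
    BddMeas (fun s : Fin n → S => ∑ i, F i (s i)) where
  meas := Finset.measurable_sum _ fun i _ => (hF i).meas.comp (measurable_pi_apply i)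
  bdd := by
    choose C hC using fun i => (hF i).bdd
    refine ⟨∑ i, C i, fun s t => ?_⟩
    rw [Finset.sum_apply]
    exact (Finset.abs_sum_le_sum_abs _ _).trans (Finset.sum_le_sum fun i _ => hC i _ _)

/-- The comparison principle: if exchanging a single summand `F i` for `G i` increases the mean of
every sup-like functional, then so does exchanging all independent summands. The functional applied
to the first summand is the average of `Φ` over the sum of the others, again sup-like. -/
theorem integral_le_integral_of_forall_supLike [Fintype T] {n : ℕ} (Q : Fin n → Measure S)
    (Q' : Fin n → Measure S')
    [∀ i, IsProbabilityMeasure (Q i)] [∀ i, IsProbabilityMeasure (Q' i)]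
    {F : Fin n → S → T → ℝ} {G : Fin n → S' → T → ℝ}
    (hF : ∀ i, BddMeas (F i)) (hG : ∀ i, BddMeas (G i))
    (h : ∀ i (Φ : (T → ℝ) → ℝ), SupLike Φ → ∀ A,
      ∫ s, Φ (A + F i s) ∂Q i ≤ ∫ s, Φ (A + G i s) ∂Q' i)
    {Φ : (T → ℝ) → ℝ} (hΦ : SupLike Φ) (A : T → ℝ) :
    ∫ s, Φ (A + ∑ i, F i (s i)) ∂Measure.pi Q ≤
      ∫ s, Φ (A + ∑ i, G i (s i)) ∂Measure.pi Q' := by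
  induction n generalizing A with
  | zero => simp
  | succ n ih =>
    rw [integral_pi_succ Q (hΦ.integrable (BddMeas.sum hF) _ A),
      integral_pi_succ Q' (hΦ.integrable (BddMeas.sum hG) _ A)]
    simp only [Fin.sum_univ_succ, Fin.cons_zero, Fin.cons_succ, ← add_assoc]
    have hG' := BddMeas.sum fun i : Fin n => hG i.succ
    have hF' := BddMeas.sum fun i : Fin n => hF i.succ
    refine le_trans (integral_mono ?_ ?_ fun r => ?_)
      (h 0 _ (hΦ.mix hG' (Measure.pi fun i => Q' i.succ)) A)
    · exact (hΦ.mix hF' (Measure.pi fun i => Q i.succ)).integrable (hF 0) _ A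
    · exact (hΦ.mix hG' (Measure.pi fun i => Q' i.succ)).integrable (hF 0) _ A
    · exact ih (fun i => Q i.succ) (fun i => Q' i.succ) (fun i => hF i.succ)
        (fun i => hG i.succ) (fun i => h i.succ) (A + F 0 r)

end Compare

/-! ### Rademacher averages: symmetrization and contraction -/

section Rademacher

/-- The law of a fair coin. -/
noncomputable def coin : Measure Bool :=
  (2⁻¹ : ℝ≥0∞) • Measure.dirac true + (2⁻¹ : ℝ≥0∞) • Measure.dirac false

instance : IsProbabilityMeasure coin where
  measure_univ := by simp [coin, ENNReal.inv_two_add_inv_two]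

theorem integral_coin (f : Bool → ℝ) : ∫ b, f b ∂coin = (f true + f false) / 2 := by
  rw [coin, integral_add_measure, integral_smul_measure, integral_smul_measure]
  · simp; ring
  all_goals
    exact (integrable_dirac (by simp)).smul_measure (by simp)

/-- The random sign encoded by a coin. -/
def sgn (b : Bool) : ℝ := if b then 1 else -1

@[simp] theorem sgn_true : sgn true = 1 := rfl
@[simp] theorem sgn_false : sgn false = -1 := rfl

theorem abs_integral_le_of_forall_abs_le {S : Type*} [MeasurableSpace S] {Q : Measure S}
    [IsProbabilityMeasure Q] {f : S → ℝ} {C : ℝ} (h : ∀ s, |f s| ≤ C) : |∫ s, f s ∂Q| ≤ C := by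
  simpa using norm_integral_le_of_norm_le_const (μ := Q) (f := f) (C := C) (ae_of_all _ h)

variable {S T : Type*} [MeasurableSpace S]

/-- The process `F` multiplied by an independent random sign, on the enlarged space `S × Bool`. -/
def signed (F : S → T → ℝ) (s : S × Bool) : T → ℝ := sgn s.2 • F s.1

theorem abs_sgn (b : Bool) : |sgn b| = 1 := by cases b <;> simp

theorem measurable_sgn : Measurable sgn := measurable_of_countable _

theorem BddMeas.const_smul {F : S → T → ℝ} (hF : BddMeas F) (c : ℝ) :
    BddMeas (fun s => c • F s) where
  meas := hF.meas.const_smul c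
  bdd := by
    obtain ⟨C, hC⟩ := hF.bdd
    refine ⟨|c| * C, fun s t => ?_⟩
    simp only [Pi.smul_apply, smul_eq_mul, abs_mul]
    exact mul_le_mul_of_nonneg_left (hC s t) (abs_nonneg c)

theorem BddMeas.add {F G : S → T → ℝ} (hF : BddMeas F) (hG : BddMeas G) :
    BddMeas (fun s => F s + G s) where
  meas := hF.meas.add hG.meas
  bdd := by
    obtain ⟨C, hC⟩ := hF.bdd
    obtain ⟨C', hC'⟩ := hG.bdd
    exact ⟨C + C', fun s t => (abs_add_le _ _).trans (add_le_add (hC s t) (hC' s t))⟩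

theorem BddMeas.neg {F : S → T → ℝ} (hF : BddMeas F) : BddMeas (fun s => -F s) := by
  simpa using hF.const_smul (-1)

theorem BddMeas.comp {S' : Type*} [MeasurableSpace S'] {F : S → T → ℝ} (hF : BddMeas F)
    {h : S' → S} (hh : Measurable h) : BddMeas (fun s => F (h s)) where
  meas := hF.meas.comp hh
  bdd := let ⟨C, hC⟩ := hF.bdd; ⟨C, fun s t => hC (h s) t⟩

theorem BddMeas.signed {F : S → T → ℝ} (hF : BddMeas F) : BddMeas (signed F) where
  meas := measurable_pi_iff.2 fun t => (measurable_sgn.comp measurable_snd).mul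
    ((measurable_pi_iff.1 hF.meas t).comp measurable_fst)
  bdd := by
    obtain ⟨C, hC⟩ := hF.bdd
    refine ⟨C, fun s t => ?_⟩
    simpa [HiddenCovariate.signed, abs_mul, abs_sgn] using hC s.1 t

theorem BddMeas.integrable {F : S → T → ℝ} (hF : BddMeas F) (Q : Measure S) [IsFiniteMeasure Q]
    (t : T) : Integrable (fun s => F s t) Q := by
  obtain ⟨C, hC⟩ := hF.bdd
  exact Integrable.of_bound (measurable_pi_iff.1 hF.meas t).aestronglyMeasurable C
    (ae_of_all _ fun s => hC s t)

variable [Fintype T]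

theorem SupLike.integral_signed {Φ : (T → ℝ) → ℝ} (h : SupLike Φ) {F : S → T → ℝ} (hF : BddMeas F)
    (Q : Measure S) [IsProbabilityMeasure Q] (A : T → ℝ) :
    ∫ s, Φ (A + signed F s) ∂(Q.prod coin) =
      ∫ s, (Φ (A + F s) + Φ (A - F s)) / 2 ∂Q := by
  rw [integral_prod _ (h.integrable hF.signed _ A)]
  simp [integral_coin, signed, sub_eq_add_neg]

/-- Jensen's inequality for a sup-like functional. -/
theorem SupLike.map_integral_le {Φ : (T → ℝ) → ℝ} (h : SupLike Φ) {F : S → T → ℝ} (hF : BddMeas F)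
    (Q : Measure S) [IsProbabilityMeasure Q] (A : T → ℝ) :
    Φ (A + fun t => ∫ s, F s t ∂Q) ≤ ∫ s, Φ (A + F s) ∂Q := by
  have hi : Integrable (fun s => A + F s) Q :=
    (integrable_const A).add (Integrable.of_eval fun t => hF.integrable Q t)
  have := h.convex.map_integral_le h.lip.continuous.continuousOn isClosed_univ
    (ae_of_all _ fun _ => mem_univ _) hi (h.integrable hF Q A)
  refine le_of_eq_of_le ?_ this
  congr 1
  rw [integral_add (integrable_const A) (Integrable.of_eval fun t => hF.integrable Q t)]
  ext t
  simp [eval_integral fun t => hF.integrable Q t]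

variable {n : ℕ} (Q : Fin n → Measure S)

/-- The Rademacher average `𝔼 sup_t ∑ᵢ εᵢ Fᵢ(sᵢ)(t)` for independent `sᵢ ∼ Q i` and independent
random signs `εᵢ`. -/
noncomputable def rad (F : Fin n → S → T → ℝ) : ℝ :=
  ∫ s, supT (∑ i, signed (F i) (s i)) ∂Measure.pi fun i => (Q i).prod coin

omit [Fintype T] in
theorem supT_smul {c : ℝ} (hc : 0 ≤ c) (A : T → ℝ) : supT (c • A) = c * supT A :=
  (Real.mul_iSup_of_nonneg hc _).symm

omit [Fintype T] in
theorem rad_smul {c : ℝ} (hc : 0 ≤ c) (F : Fin n → S → T → ℝ) :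
    rad Q (fun i s => c • F i s) = c * rad Q F := by
  rw [rad, rad, ← integral_const_mul]
  congr 1 with s
  rw [← supT_smul hc, Finset.smul_sum]
  congr 2 with i
  simp [signed, mul_left_comm]

variable [∀ i, IsProbabilityMeasure (Q i)] [Nonempty T] {F G H : Fin n → S → T → ℝ}

/-- Symmetrization. One summand at a time this is convexity, as `F - 𝔼F` is the midpoint of `2F` and
`-2𝔼F`, followed by Jensen's inequality for `-2F`; no ghost sample is needed. -/
theorem integral_supT_sum_sub_integral_le (hF : ∀ i, BddMeas (F i)) :
    ∫ s, supT (∑ i, (F i (s i) - fun t => ∫ r, F i r t ∂Q i)) ∂Measure.pi Q ≤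
      rad Q (fun i s => (2 : ℝ) • F i s) := by
  have hF' : ∀ i, BddMeas (fun s => F i s - fun t => ∫ r, F i r t ∂Q i) := fun i => by
    refine ⟨(hF i).meas.sub_const _, ?_⟩
    obtain ⟨C, hC⟩ := (hF i).bdd
    refine ⟨C + C, fun s t => (abs_sub _ _).trans (add_le_add (hC s t) ?_)⟩
    exact abs_integral_le_of_forall_abs_le fun r => hC r t
  have := integral_le_integral_of_forall_supLike Q (fun i => (Q i).prod coin) hF'
    (fun i => ((hF i).const_smul 2).signed) ?_ supLike_supT 0
  · simpa [rad] using this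
  intro i Φ hΦ A
  have h2 := (hF i).const_smul 2
  have I1 := hΦ.integrable h2 (Q i) A
  have I2 := hΦ.integrable h2.neg (Q i) A
  simp only [← sub_eq_add_neg] at I2
  rw [hΦ.integral_signed h2, integral_div, integral_add I1 I2]
  set m : T → ℝ := fun t => ∫ r, F i r t ∂Q i
  have hm : Φ (A - (2 : ℝ) • m) ≤ ∫ s, Φ (A - (2 : ℝ) • F i s) ∂Q i := by
    have := hΦ.map_integral_le h2.neg (Q i) A
    simp only [← sub_eq_add_neg] at this
    refine le_of_eq_of_le ?_ this
    congr 1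
    ext t
    simp [m, integral_neg, integral_const_mul, sub_eq_add_neg]
  have : ∫ s, Φ (A + (F i s - m)) ∂Q i ≤
      ∫ s, ((1 / 2) * Φ (A + (2 : ℝ) • F i s) + (1 / 2) * Φ (A - (2 : ℝ) • m)) ∂Q i := by
    refine integral_mono (hΦ.integrable (hF' i) _ A) ((I1.const_mul _).add (integrable_const _))
      fun s => ?_
    have := hΦ.convex.2 (mem_univ (A + (2 : ℝ) • F i s)) (mem_univ (A - (2 : ℝ) • m))
      (show (0 : ℝ) ≤ 1 / 2 by norm_num) (show (0 : ℝ) ≤ 1 / 2 by norm_num) (by norm_num)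
    refine le_of_eq_of_le ?_ this
    congr 1
    ext t
    simp
    ring
  rw [integral_add (I1.const_mul _) (integrable_const _), integral_const_mul] at this
  simp at this
  linarith

theorem BddMeas.integrable_supT {F : S → T → ℝ} (hF : BddMeas F) (Q : Measure S)
    [IsFiniteMeasure Q] : Integrable (fun s => supT (F s)) Q := by
  simpa using supLike_supT.integrable hF Q 0

theorem rad_add_le (hF : ∀ i, BddMeas (F i)) (hG : ∀ i, BddMeas (G i)) :
    rad Q (fun i s => F i s + G i s) ≤ rad Q F + rad Q G := by
  rw [rad, rad, rad, ← integral_add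
    ((BddMeas.sum fun i => (hF i).signed).integrable_supT _)
    ((BddMeas.sum fun i => (hG i).signed).integrable_supT _)]
  refine integral_mono ((BddMeas.sum fun i => ((hF i).add (hG i)).signed).integrable_supT _)
    (((BddMeas.sum fun i => (hF i).signed).integrable_supT _).add
    ((BddMeas.sum fun i => (hG i).signed).integrable_supT _)) fun s => supT_le fun t => ?_
  refine le_of_eq_of_le ?_ (add_le_add (le_supT (∑ i, signed (F i) (s i)) t)
    (le_supT (∑ i, signed (G i) (s i)) t))
  simp [signed, Finset.sum_apply, Finset.sum_add_distrib]

/-- The contraction principle: processes with smaller increments have smaller Rademacher averages.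
-/
theorem rad_le_of_abs_sub_le (hF : ∀ i, BddMeas (F i)) (hG : ∀ i, BddMeas (G i))
    (h : ∀ i s t t', |F i s t - F i s t'| ≤ |G i s t - G i s t'|) : rad Q F ≤ rad Q G := by
  have := integral_le_integral_of_forall_supLike (fun i => (Q i).prod coin)
    (fun i => (Q i).prod coin) (fun i => (hF i).signed) (fun i => (hG i).signed) ?_
    (supLike_supT (T := T)) 0
  · simpa [rad] using this
  intro i Φ hΦ A
  rw [hΦ.integral_signed (hF i), hΦ.integral_signed (hG i)]
  have J : ∀ {F : S → T → ℝ}, BddMeas F →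
      Integrable (fun s => (Φ (A + F s) + Φ (A - F s)) / 2) (Q i) := fun hF => by
    have := hΦ.integrable hF.neg (Q i) A
    simp only [← sub_eq_add_neg] at this
    exact ((hΦ.integrable hF (Q i) A).add this).div_const _
  refine integral_mono (J (hF i)) (J (hG i)) fun s => ?_
  have := hΦ.contr A (F i s) (G i s) 0 fun t t' => (h i s t t').trans (le_max_left _ _)
  simp only [add_zero, sub_zero] at this
  simp only
  linarith

theorem integral_coin_prod_coin (f : Bool × Bool → ℝ) : ∫ b, f b ∂coin.prod coin =
    ((f (true, true) + f (true, false)) / 2 + (f (false, true) + f (false, false)) / 2) / 2 := by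
  rw [integral_prod _ (Integrable.of_finite), integral_coin, integral_coin, integral_coin]

/-- A Rademacher average may be computed with any independent pairs whose laws are those of a point
and an independent sign. -/
theorem integral_supT_signed_comp {h : S × Bool × Bool → S × Bool} (hh : Measurable h)
    (hQ : ∀ i, ((Q i).prod (coin.prod coin)).map h = (Q i).prod coin) (hF : ∀ i, BddMeas (F i)) :
    ∫ s, supT (∑ i, signed (F i) (h (s i))) ∂Measure.pi (fun i => (Q i).prod (coin.prod coin)) =
      rad Q F := by
  have I := fun (i : Fin n) (Φ : (T → ℝ) → ℝ) (hΦ : SupLike Φ) (A : T → ℝ) =>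
    integral_map hh.aemeasurable
      ((hQ i).symm ▸ (hΦ.integrable (hF i).signed ((Q i).prod coin) A).aestronglyMeasurable)
  simp only [hQ] at I
  refine le_antisymm ?_ ?_
  · have := integral_le_integral_of_forall_supLike (fun i => (Q i).prod (coin.prod coin))
      (fun i => (Q i).prod coin) (fun i => (hF i).signed.comp hh) (fun i => (hF i).signed)
      (fun i Φ hΦ A => (I i Φ hΦ A).ge) (supLike_supT (T := T)) 0
    simpa [rad] using this
  · have := integral_le_integral_of_forall_supLike (fun i => (Q i).prod coin)
      (fun i => (Q i).prod (coin.prod coin)) (fun i => (hF i).signed)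
      (fun i => (hF i).signed.comp hh) (fun i Φ hΦ A => (I i Φ hΦ A).le) (supLike_supT (T := T)) 0
    simpa [rad] using this

/-- The contraction principle for increments that are controlled by two processes. As `|ΔG| + |ΔH| ≤
max |2ΔG| |2ΔH|`, the field `SupLike.contr` splits the process with two independent signs, which is
where both factors `2` come from. -/
theorem rad_le_of_abs_sub_le_add (hF : ∀ i, BddMeas (F i)) (hG : ∀ i, BddMeas (G i))
    (hH : ∀ i, BddMeas (H i))
    (h : ∀ i s t t', |F i s t - F i s t'| ≤ |G i s t - G i s t'| + |H i s t - H i s t'|) :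
    rad Q F ≤ 2 * rad Q G + 2 * rad Q H := by
  -- two independent signs for each summand, one for each of the two processes
  let h₁ : S × Bool × Bool → S × Bool := fun s => (s.1, s.2.1)
  let h₂ : S × Bool × Bool → S × Bool := fun s => (s.1, s.2.2)
  have m₁ : Measurable h₁ := by fun_prop
  have m₂ : Measurable h₂ := by fun_prop
  have e₁ : ∀ i, ((Q i).prod (coin.prod coin)).map h₁ = (Q i).prod coin := fun i => by
    have := Measure.map_prod_map (Q i) (coin.prod coin) measurable_id
      (measurable_fst (α := Bool) (β := Bool))
    rw [Measure.map_id, ← Measure.fst, Measure.fst_prod] at this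
    exact this.symm
  have e₂ : ∀ i, ((Q i).prod (coin.prod coin)).map h₂ = (Q i).prod coin := fun i => by
    have := Measure.map_prod_map (Q i) (coin.prod coin) measurable_id
      (measurable_snd (α := Bool) (β := Bool))
    rw [Measure.map_id, ← Measure.snd, Measure.snd_prod] at this
    exact this.symm
  have hG2 := fun i => (hG i).const_smul 2
  have hH2 := fun i => (hH i).const_smul 2
  have hG' := fun i => (hG2 i).signed.comp m₁
  have hH' := fun i => (hH2 i).signed.comp m₂
  rw [← rad_smul _ (by norm_num), ← rad_smul _ (by norm_num),
    ← integral_supT_signed_comp Q m₁ e₁ hG2, ← integral_supT_signed_comp Q m₂ e₂ hH2,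
    ← integral_add ((BddMeas.sum hG').integrable_supT _) ((BddMeas.sum hH').integrable_supT _)]
  have key := integral_le_integral_of_forall_supLike (fun i => (Q i).prod coin)
    (fun i => (Q i).prod (coin.prod coin)) (fun i => (hF i).signed)
    (fun i => (hG' i).add (hH' i)) ?_ (supLike_supT (T := T)) 0
  · simp only [zero_add] at key
    refine key.trans (integral_mono
      ((BddMeas.sum fun i => (hG' i).add (hH' i)).integrable_supT _)
      (((BddMeas.sum hG').integrable_supT _).add ((BddMeas.sum hH').integrable_supT _))
      fun s => supT_le fun t => ?_)
    rw [Finset.sum_add_distrib]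
    exact add_le_add (le_supT _ t) (le_supT _ t)
  · intro i Φ hΦ A
    have I := hΦ.integrable ((hG' i).add (hH' i)) ((Q i).prod (coin.prod coin)) A
    rw [hΦ.integral_signed (hF i), integral_prod _ I]
    have J := hΦ.integrable (hF i).neg (Q i) A
    simp only [← sub_eq_add_neg] at J
    refine integral_mono (((hΦ.integrable (hF i) (Q i) A).add J).div_const _)
      I.integral_prod_left fun s => ?_
    have := hΦ.contr A (F i s) ((2 : ℝ) • G i s) ((2 : ℝ) • H i s) fun t t' => by
      refine (h i s t t').trans ?_
      simp only [Pi.smul_apply, smul_eq_mul, ← mul_sub, abs_mul, abs_two]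
      rcases le_total |G i s t - G i s t'| |H i s t - H i s t'| with h' | h'
      · exact le_max_of_le_right (by linarith)
      · exact le_max_of_le_left (by linarith)
    simp only [integral_coin_prod_coin, signed, h₁, h₂, sgn_true, sgn_false, one_smul, neg_smul]
    simp only [sub_eq_add_neg, neg_add, neg_neg] at this ⊢
    linarith

end Rademacher

/-! ### Rademacher averages of conditional means -/

section Jensen

variable {S W T : Type*} [MeasurableSpace S] [MeasurableSpace W] {n : ℕ}

theorem BddMeas.integral_kernel {F : W → T → ℝ} (hF : BddMeas F) (κ : Kernel S W)
    [IsMarkovKernel κ] : BddMeas (fun y t => ∫ z, F z t ∂κ y) where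
  meas := measurable_pi_iff.2 fun t =>
    ((measurable_pi_iff.1 hF.meas t).stronglyMeasurable.integral_kernel (κ := κ)).measurable
  bdd := by
    obtain ⟨C, hC⟩ := hF.bdd
    exact ⟨C, fun y t => abs_integral_le_of_forall_abs_le fun r => hC r t⟩

theorem integral_measure_comp {ρ : Measure S} {κ : Kernel S W} {f : W → ℝ}
    (hf : Integrable f (κ ∘ₘ ρ)) : ∫ z, f z ∂(κ ∘ₘ ρ) = ∫ y, ∫ z, f z ∂κ y ∂ρ := by
  rw [Measure.comp_eq_comp_const_apply] at hf ⊢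
  simpa using Kernel.integral_comp hf

theorem integrable_integral_kernel {ρ : Measure S} {κ : Kernel S W} {f : W → ℝ}
    (hf : Integrable f (κ ∘ₘ ρ)) : Integrable (fun y => ∫ z, f z ∂κ y) ρ := by
  rw [Measure.comp_eq_comp_const_apply] at hf
  simpa using hf.integral_comp

/-- Passing to conditional means decreases Rademacher averages, by Jensen's inequality: the average
on the right is taken over the law of the hidden points, the mixture `κ ∘ₘ ρ` of the conditional
laws. -/
theorem rad_integral_kernel_le [Fintype T] [Nonempty T] (ρ : Fin n → Measure S)
    [∀ i, IsProbabilityMeasure (ρ i)] (κ : Fin n → Kernel S W) [∀ i, IsMarkovKernel (κ i)]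
    {F : Fin n → W → T → ℝ}
    (hF : ∀ i, BddMeas (F i)) :
    rad ρ (fun i y t => ∫ z, F i z t ∂κ i y) ≤ rad (fun i => κ i ∘ₘ ρ i) F := by
  have hF' := fun i => (hF i).integral_kernel (κ i)
  have := integral_le_integral_of_forall_supLike (fun i => (ρ i).prod coin)
    (fun i => (κ i ∘ₘ ρ i).prod coin) (fun i => (hF' i).signed) (fun i => (hF i).signed) ?_
    (supLike_supT (T := T)) 0
  · simpa [rad] using this
  intro i Φ hΦ A
  have J : ∀ (Q : Measure W) [IsProbabilityMeasure Q],
      Integrable (fun s => Φ (A - F i s)) Q := fun Q _ => by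
    simpa only [← sub_eq_add_neg] using hΦ.integrable (hF i).neg Q A
  have J' : Integrable (fun s => Φ (A - fun t => ∫ z, F i z t ∂κ i s)) (ρ i) := by
    simpa only [← sub_eq_add_neg] using hΦ.integrable (hF' i).neg (ρ i) A
  have JJ : Integrable (fun z => (Φ (A + F i z) + Φ (A - F i z)) / 2) (κ i ∘ₘ ρ i) :=
    ((hΦ.integrable (hF i) (κ i ∘ₘ ρ i) A).add (J _)).div_const 2
  rw [hΦ.integral_signed (hF' i), hΦ.integral_signed (hF i), integral_measure_comp JJ]
  refine integral_mono (((hΦ.integrable (hF' i) _ A).add J').div_const _)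
    (integrable_integral_kernel JJ) fun y => ?_
  have h1 := hΦ.map_integral_le (hF i) (κ i y) A
  have h2 := hΦ.map_integral_le (hF i).neg (κ i y) A
  simp only [Pi.neg_apply, integral_neg, ← sub_eq_add_neg] at h2
  rw [integral_div, integral_add (hΦ.integrable (hF i) _ A) (J _)]
  have e : (A + fun t => -∫ z, F i z t ∂κ i y) = A - fun t => ∫ z, F i z t ∂κ i y := by
    ext t; simp [sub_eq_add_neg]
  rw [e] at h2
  linarith

end Jensen

/-! ### Bounded differences and maxima of sub-Gaussian variables -/

section Concentration

variable {S : Type*} [MeasurableSpace S]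

/-- McDiarmid's inequality in terms of moment generating functions: a function of independent
variables that changes by at most `c i` when its `i`-th argument changes is sub-Gaussian around its
mean with variance proxy `∑ᵢ (cᵢ/2)²`. By induction on the number of variables, with Hoeffding's
lemma for the mean over all variables but the first. -/
theorem hasSubgaussianMGF_of_bounded_differences {n : ℕ} (Q : Fin n → Measure S)
    [∀ i, IsProbabilityMeasure (Q i)] {f : (Fin n → S) → ℝ} (hf : Measurable f)
    (hb : ∃ C, ∀ s, |f s| ≤ C) {c : Fin n → ℝ≥0}
    (h : ∀ i s r, |f s - f (Function.update s i r)| ≤ c i) :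
    HasSubgaussianMGF (fun s => f s - ∫ r, f r ∂Measure.pi Q) (∑ i, (c i / 2) ^ 2)
      (Measure.pi Q) := by
  have hint : ∀ {m : ℕ} (Q : Fin m → Measure S) [∀ i, IsProbabilityMeasure (Q i)]
      {f : (Fin m → S) → ℝ} (_ : Measurable f) (_ : ∃ C, ∀ s, |f s| ≤ C) (t : ℝ),
      Integrable (fun s => Real.exp (t * (f s - ∫ r, f r ∂Measure.pi Q))) (Measure.pi Q) := by
    intro m Q _ f hf ⟨C, hC⟩ t
    refine integrable_exp_mul_of_mem_Icc (a := -C - ∫ r, f r ∂Measure.pi Q)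
      (b := C - ∫ r, f r ∂Measure.pi Q) (by fun_prop) (ae_of_all _ fun s => ?_)
    have := abs_le.1 (hC s)
    constructor <;> linarith
  refine ⟨hint Q hf hb, fun t => ?_⟩
  induction n with
  | zero =>
    have : ∀ s, f s = f default := fun s => by rw [Subsingleton.elim s default]
    simp [mgf, this]
  | succ n ih =>
    obtain ⟨C, hC⟩ := hb
    let Q' : Fin n → Measure S := fun i => Q i.succ
    have hcons : Measurable fun rs : S × (Fin n → S) => (Fin.cons rs.1 rs.2 : Fin (n + 1) → S) := by
      refine measurable_pi_iff.2 fun i => ?_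
      refine Fin.cases ?_ (fun i => ?_) i
      · simpa using measurable_fst
      · simpa using (by fun_prop : Measurable fun x : S × (Fin n → S) => x.2 i)
    -- the conditional mean of `f` given the first variable
    let h0 : S → ℝ := fun r => ∫ s, f (Fin.cons r s) ∂Measure.pi Q'
    have hI : Integrable f (Measure.pi Q) :=
      Integrable.of_bound hf.aestronglyMeasurable C (ae_of_all _ hC)
    have hE : ∫ s, f s ∂Measure.pi Q = ∫ r, h0 r ∂Q 0 := integral_pi_succ Q hI
    have hfc : ∀ r, Measurable fun s : Fin n → S => f (Fin.cons r s) := fun r =>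
      hf.comp (hcons.comp (measurable_prodMk_left))
    have hIc : ∀ r, Integrable (fun s : Fin n → S => f (Fin.cons r s)) (Measure.pi Q') := fun r =>
      Integrable.of_bound (hfc r).aestronglyMeasurable C (ae_of_all _ fun s => hC _)
    have hh0 : Measurable h0 :=
      ((hf.comp hcons).stronglyMeasurable.integral_prod_right').measurable
    have hosc : ∀ r r', h0 r - h0 r' ≤ c 0 := by
      intro r r'
      have : ∫ s, (f (Fin.cons r s) - f (Fin.cons r' s)) ∂Measure.pi Q' ≤ c 0 := by
        refine (le_abs_self _).trans (abs_integral_le_of_forall_abs_le fun s => ?_)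
        have := h 0 (Fin.cons r s) r'
        rwa [Fin.update_cons_zero] at this
      rwa [integral_sub (hIc r) (hIc r')] at this
    have hinner : ∀ r, ∫ s, Real.exp (t * (f (Fin.cons r s) - h0 r)) ∂Measure.pi Q' ≤
        Real.exp ((∑ i : Fin n, (c i.succ / 2) ^ 2 : ℝ≥0) * t ^ 2 / 2) := fun r =>
      ih Q' (hfc r) ⟨C, fun s => hC _⟩ (c := fun i => c i.succ) fun i s r' => by
        have := h i.succ (Fin.cons r s) r'
        rwa [← Fin.cons_update] at this
    have houter : ∫ r, Real.exp (t * (h0 r - ∫ r, h0 r ∂Q 0)) ∂Q 0 ≤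
        Real.exp (((c 0 / 2) ^ 2 : ℝ≥0) * t ^ 2 / 2) := by
      have : Nonempty S := nonempty_of_isProbabilityMeasure (Q 0)
      have hbb : BddBelow (range h0) := by
        obtain ⟨r0⟩ := this
        exact ⟨h0 r0 - c 0, by rintro _ ⟨r, rfl⟩; linarith [hosc r0 r]⟩
      have := hasSubgaussianMGF_of_mem_Icc (μ := Q 0) (X := h0) (a := ⨅ r, h0 r)
        (b := (⨅ r, h0 r) + c 0) hh0.aemeasurable (ae_of_all _ fun r =>
          ⟨ciInf_le hbb r, by
            have : h0 r - c 0 ≤ ⨅ r, h0 r := le_ciInf fun r' => by linarith [hosc r r']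
            linarith⟩)
      simpa [mgf] using this.mgf_le t
    rw [mgf, integral_pi_succ Q (hint Q hf ⟨C, hC⟩ t)]
    have hsplit : ∀ r, ∫ s, Real.exp (t * (f (Fin.cons r s) - ∫ r, f r ∂Measure.pi Q))
        ∂Measure.pi Q' = Real.exp (t * (h0 r - ∫ r, h0 r ∂Q 0)) *
        ∫ s, Real.exp (t * (f (Fin.cons r s) - h0 r)) ∂Measure.pi Q' := fun r => by
      rw [← integral_const_mul, hE]
      congr 1 with s
      rw [← Real.exp_add]
      congr 1
      ring
    have hI0 : Integrable (fun r => Real.exp (t * (h0 r - ∫ r, h0 r ∂Q 0))) (Q 0) := by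
      refine integrable_exp_mul_of_mem_Icc (a := -C - ∫ r, h0 r ∂Q 0)
        (b := C - ∫ r, h0 r ∂Q 0) (by fun_prop) (ae_of_all _ fun r => ?_)
      have : |h0 r| ≤ C := abs_integral_le_of_forall_abs_le fun s => hC _
      have := abs_le.1 this
      constructor <;> linarith
    calc ∫ r, ∫ s, Real.exp (t * (f (Fin.cons r s) - ∫ r, f r ∂Measure.pi Q))
          ∂Measure.pi Q' ∂Q 0
        ≤ ∫ r, Real.exp (t * (h0 r - ∫ r, h0 r ∂Q 0)) *
          Real.exp ((∑ i : Fin n, (c i.succ / 2) ^ 2 : ℝ≥0) * t ^ 2 / 2) ∂Q 0 := by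
          refine integral_mono_of_nonneg (ae_of_all _ fun r => integral_nonneg fun s =>
            (Real.exp_pos _).le) (hI0.mul_const _) (ae_of_all _ fun r => ?_)
          simp only
          rw [hsplit]
          exact mul_le_mul_of_nonneg_left (hinner r) (Real.exp_pos _).le
      _ ≤ Real.exp (((c 0 / 2) ^ 2 : ℝ≥0) * t ^ 2 / 2) *
          Real.exp ((∑ i : Fin n, (c i.succ / 2) ^ 2 : ℝ≥0) * t ^ 2 / 2) := by
          rw [integral_mul_const]
          exact mul_le_mul_of_nonneg_right houter (Real.exp_pos _).le
      _ = _ := by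
          rw [← Real.exp_add, Fin.sum_univ_succ]
          congr 1
          push_cast
          ring

theorem measureReal_lt_le_of_hasSubgaussianMGF {Ω : Type*} [MeasurableSpace Ω] {P : Measure Ω}
    [IsProbabilityMeasure P] {X : Ω → ℝ} {c : ℝ≥0} (h : HasSubgaussianMGF X c P) {q : ℝ}
    (hq : 0 < q) (hq1 : q ≤ 1) : P.real {w | √(2 * c * Real.log (1 / q)) < X w} ≤ q := by
  have hlog : 0 ≤ Real.log (1 / q) := Real.log_nonneg (by rw [le_div_iff₀ hq]; linarith)
  rcases eq_or_ne c 0 with rfl | hc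
  -- the Chernoff bound divides by `c`
  · have h0 := h.ae_eq_zero_of_hasSubgaussianMGF_zero
    have : P.real {w | √(2 * (0 : ℝ≥0) * Real.log (1 / q)) < X w} = 0 := by
      rw [measureReal_eq_zero_iff, ← compl_compl {w | _}, ← mem_ae_iff]
      filter_upwards [h0] with w hw
      simp [hw]
    linarith
  · refine (measureReal_mono (s₂ := {w | √(2 * c * Real.log (1 / q)) ≤ X w})
      (fun w (hw : √(2 * c * Real.log (1 / q)) < X w) => hw.le)).trans
      ((h.measure_ge_le (Real.sqrt_nonneg _)).trans ?_)
    rw [Real.sq_sqrt (by positivity), neg_div, mul_div_cancel_left₀ _ (by positivity),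
      ← Real.log_inv, one_div, inv_inv, Real.exp_log hq]

/-- The mean of the maximum of `K` sub-Gaussian variables with variance proxy `c` is at most `√(2 c
ln K)`. -/
theorem integral_supT_le_of_hasSubgaussianMGF {Ω K : Type*} [MeasurableSpace Ω] [Fintype K]
    {P : Measure Ω} [IsProbabilityMeasure P] {Z : K → Ω → ℝ} {c : ℝ≥0}
    (hK : 1 < Fintype.card K) (hZ : ∀ k, HasSubgaussianMGF (Z k) c P)
    (hI : Integrable (fun w => supT fun k => Z k w) P) :
    ∫ w, supT (fun k => Z k w) ∂P ≤ √(2 * Real.log (Fintype.card K)) * √c := by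
  have : Nonempty K := Fintype.card_pos_iff.1 (by omega)
  have hl : 0 < Real.log (Fintype.card K) := Real.log_pos (by exact_mod_cast hK)
  set E := ∫ w, supT (fun k => Z k w) ∂P
  set l := Real.log (Fintype.card K)
  -- Jensen's inequality for `exp`, and a maximum of exponentials is at most their sum
  have key : ∀ t : ℝ, 0 < t → t * E ≤ l + c * t ^ 2 / 2 := by
    intro t ht
    have hle : ∀ w, Real.exp (t * supT fun k => Z k w) ≤ ∑ k, Real.exp (t * Z k w) := by
      intro w
      obtain ⟨k, hk⟩ := exists_supT fun k => Z k w
      rw [hk]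
      exact Finset.single_le_sum (f := fun k => Real.exp (t * Z k w))
        (fun _ _ => (Real.exp_pos _).le) (Finset.mem_univ k)
    have hS : Integrable (fun w => ∑ k, Real.exp (t * Z k w)) P :=
      integrable_finsetSum _ fun k _ => (hZ k).integrable_exp_mul t
    have hIe : Integrable (fun w => Real.exp (t * supT fun k => Z k w)) P :=
      hS.mono' (Real.continuous_exp.comp_aestronglyMeasurable (hI.1.const_mul t))
        (ae_of_all _ fun w => by simpa using hle w)
    have h1 : Real.exp (t * E) ≤ ∫ w, Real.exp (t * supT fun k => Z k w) ∂P := by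
      have := convexOn_exp.map_integral_le (μ := P) (f := fun w => t * supT fun k => Z k w)
        Real.continuous_exp.continuousOn isClosed_univ (ae_of_all _ fun _ => mem_univ _)
        (hI.const_mul t) hIe
      rwa [integral_const_mul] at this
    have h2 : ∫ w, Real.exp (t * supT fun k => Z k w) ∂P ≤
        Fintype.card K * Real.exp (c * t ^ 2 / 2) := by
      refine (integral_mono hIe hS hle).trans ?_
      rw [integral_finsetSum _ fun k _ => (hZ k).integrable_exp_mul t]
      refine (Finset.sum_le_sum fun k _ => (hZ k).mgf_le t).trans (by simp)
    have h3 := Real.log_le_log (Real.exp_pos _) (h1.trans h2)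
    rwa [Real.log_exp, Real.log_mul (by positivity) (Real.exp_pos _).ne', Real.log_exp] at h3
  rcases eq_or_ne c 0 with rfl | hc
  -- for `c = 0` the optimal `t` below would be infinite
  · simp only [NNReal.coe_zero, zero_mul, zero_div, add_zero, Real.sqrt_zero, mul_zero] at key ⊢
    by_contra! hE
    have := key ((l + 1) / E) (by positivity)
    rw [div_mul_cancel₀ _ hE.ne'] at this
    linarith
  · have hc' : (0 : ℝ) < c := by positivity
    have hs : 0 < √(c : ℝ) := Real.sqrt_pos.2 hc'
    have hr : 0 < √(2 * l) := Real.sqrt_pos.2 (by positivity)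
    -- this `t` minimizes `l / t + c t / 2`
    have := key (√(2 * l) / √c) (by positivity)
    rw [div_pow, Real.sq_sqrt hc'.le, Real.sq_sqrt (by positivity)] at this
    have h4 : l + c * (2 * l / c) / 2 = √(2 * l) * √(2 * l) := by
      rw [Real.mul_self_sqrt (by positivity)]; field_simp; ring
    rw [h4, div_mul_eq_mul_div, div_le_iff₀ hs, mul_assoc] at this
    exact le_of_mul_le_mul_left this hr

end Concentration

/-! ### Rademacher averages of linear functions of the covariates -/

section MaxCol

variable {n p : ℕ}

theorem integral_sgn_sum (a : Fin n → ℝ) :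
    ∫ b, ∑ i, sgn (b i) * a i ∂Measure.pi (fun _ : Fin n => coin) = 0 := by
  rw [integral_finsetSum _ fun i _ => Integrable.of_finite]
  refine Finset.sum_eq_zero fun i _ => ?_
  rw [integral_mul_const]
  have h := integral_map (μ := Measure.pi fun _ : Fin n => coin)
    (measurable_pi_apply i).aemeasurable (f := sgn)
    measurable_sgn.aestronglyMeasurable
  rw [(measurePreserving_eval (fun _ : Fin n => coin) i).map_eq, integral_coin] at h
  simp at h
  simp [← h]

theorem hasSubgaussianMGF_sgn_sum (a : Fin n → ℝ) {c : ℝ≥0} (hc : ∑ i, a i ^ 2 ≤ c) :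
    HasSubgaussianMGF (fun b : Fin n → Bool => ∑ i, sgn (b i) * a i) c
      (Measure.pi fun _ => coin) := by
  have := hasSubgaussianMGF_of_bounded_differences (fun _ : Fin n => coin)
    (f := fun b : Fin n → Bool => ∑ i, sgn (b i) * a i) (measurable_of_countable _)
    ⟨∑ i, |a i|, fun b => (Finset.abs_sum_le_sum_abs _ _).trans
      (Finset.sum_le_sum fun i _ => by rw [abs_mul, abs_sgn, one_mul])⟩
    (c := fun i => 2 * ‖a i‖₊) fun i s r => by
      rw [← Finset.sum_sub_distrib, Finset.sum_eq_single i]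
      · rw [Function.update_self, ← sub_mul, abs_mul]
        push_cast
        refine mul_le_mul_of_nonneg_right ((abs_sub _ _).trans ?_) (abs_nonneg _)
        rw [abs_sgn, abs_sgn]; norm_num
      · intro j _ hj
        rw [Function.update_of_ne hj, sub_self]
      · simp
  simp only [integral_sgn_sum, sub_zero] at this
  refine ⟨this.1, fun t => (this.2 t).trans (Real.exp_le_exp.2 ?_)⟩
  gcongr
  rw [← NNReal.coe_le_coe]
  refine le_trans (le_of_eq ?_) hc
  push_cast
  exact Finset.sum_congr rfl fun i _ => by simp

theorem sqrt_le_maxColNorm (X : Fin n → Fin p → ℝ) (j : Fin p) :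
    √(∑ i, X i j ^ 2) ≤ maxColNorm X :=
  le_supT (fun j => √(∑ i, X i j ^ 2)) j

theorem maxColNorm_nonneg (X : Fin n → Fin p → ℝ) : 0 ≤ maxColNorm X :=
  Real.iSup_nonneg fun _ => Real.sqrt_nonneg _

/-- The `2p` variables `±∑ᵢ εᵢ X_{ij}` have variance proxy at most `S_X²`. -/
theorem integral_supT_sgn_sum_le (hp : 0 < p) (X : Fin n → Fin p → ℝ) :
    ∫ b, supT (fun k : Fin p × Bool => sgn k.2 * ∑ i, sgn (b i) * X i k.1)
      ∂Measure.pi (fun _ : Fin n => coin) ≤ √(2 * Real.log (2 * p)) * maxColNorm X := by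
  obtain ⟨c, hc⟩ : ∃ c : ℝ≥0, (c : ℝ) = maxColNorm X ^ 2 := ⟨⟨_, sq_nonneg _⟩, rfl⟩
  have h := integral_supT_le_of_hasSubgaussianMGF (K := Fin p × Bool)
    (P := Measure.pi fun _ : Fin n => coin)
    (Z := fun k b => sgn k.2 * ∑ i, sgn (b i) * X i k.1)
    (c := c) (by simp; omega) (fun k => ?_) Integrable.of_finite
  · rw [hc, Real.sqrt_sq (maxColNorm_nonneg X)] at h
    simpa [mul_comm] using h
  · have := hasSubgaussianMGF_sgn_sum (fun i => sgn k.2 * X i k.1)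
      (c := c) ?_
    · simpa only [Finset.mul_sum, mul_left_comm] using this
    · have h2 : ∀ i, (sgn k.2 * X i k.1) ^ 2 = X i k.1 ^ 2 := fun i => by
        rw [← sq_abs, abs_mul, abs_sgn, one_mul, sq_abs]
      simp only [h2, hc]
      exact Real.sqrt_le_left (maxColNorm_nonneg X) |>.1 (sqrt_le_maxColNorm X k.1)

theorem measurable_maxColNorm : Measurable (maxColNorm : (Fin n → Fin p → ℝ) → ℝ) := by
  rcases Nat.eq_zero_or_pos p with rfl | hp
  · have : (maxColNorm : (Fin n → Fin 0 → ℝ) → ℝ) = fun _ => 0 :=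
      funext fun X => Real.iSup_of_isEmpty _
    rw [this]
    exact measurable_const
  · have : Nonempty (Fin p) := ⟨⟨0, hp⟩⟩
    exact (supLike_supT (T := Fin p)).lip.continuous.measurable.comp (by fun_prop)

theorem maxColNorm_le {X : Fin n → Fin p → ℝ} {M : ℝ} (hX : ∀ i, ‖X i‖ ≤ M) :
    maxColNorm X ≤ √(n * M ^ 2) := by
  refine Real.iSup_le (fun j => Real.sqrt_le_sqrt ?_) (Real.sqrt_nonneg _)
  refine (Finset.sum_le_sum fun i _ => ?_ : _ ≤ ∑ _i : Fin n, M ^ 2).trans (by simp)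
  rw [← sq_abs]
  have := (norm_le_pi_norm (X i) j).trans (hX i)
  exact pow_le_pow_left₀ (abs_nonneg _) this 2

theorem abs_dotProduct_le (v w : Fin p → ℝ) {M : ℝ} (hv : ∀ j, |v j| ≤ M) :
    |v ⬝ᵥ w| ≤ M * l1norm w := by
  rw [dotProduct, l1norm, Finset.mul_sum]
  refine (Finset.abs_sum_le_sum_abs _ _).trans (Finset.sum_le_sum fun j _ => ?_)
  rw [abs_mul]
  exact mul_le_mul_of_nonneg_right (hv j) (abs_nonneg _)

theorem l1norm_nonneg (v : Fin p → ℝ) : 0 ≤ l1norm v := Finset.sum_nonneg fun _ _ => abs_nonneg _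

/-- The Rademacher average of the linear functions `z ↦ K ⟨xᵢ(z), δ⟩`: by duality of the `ℓ₁` and
the `ℓ_∞` norm, it is at most `K R` times the mean of `max_j |∑ᵢ εᵢ xᵢⱼ|`, and conditionally on the
covariates that is a maximum of `2p` sub-Gaussian variables. -/
theorem rad_dotProduct_le {W T : Type*} [MeasurableSpace W] [Fintype T] [Nonempty T]
    (ξ : Fin n → Measure W) [∀ i, IsProbabilityMeasure (ξ i)] (hp : 0 < p)
    {x : Fin n → W → Fin p → ℝ} (hx : ∀ i, Measurable (x i)) {M : ℝ} (hM : ∀ i z, ‖x i z‖ ≤ M)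
    {δ : T → Fin p → ℝ} {R : ℝ} (hR : ∀ t, l1norm (δ t) ≤ R) {K : ℝ} (hK : 0 ≤ K) :
    rad ξ (fun i z t => K * (x i z ⬝ᵥ δ t)) ≤
      K * (R * √(2 * Real.log (2 * p)) *
        ∫ z, maxColNorm (fun i => x i (z i)) ∂Measure.pi ξ) := by
  have : Nonempty (Fin p) := ⟨⟨0, hp⟩⟩
  by_cases hn : n = 0
  · subst hn
    simp [rad, maxColNorm, supT]
  have : ∀ i, Nonempty W := fun i : Fin n =>
    nonempty_of_isProbabilityMeasure (ξ i)
  have hM0 : 0 ≤ M := by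
    have i0 : Fin n := ⟨0, Nat.pos_of_ne_zero hn⟩
    obtain ⟨z⟩ := this i0
    exact (norm_nonneg _).trans (hM i0 z)
  have hR0 : 0 ≤ R := (l1norm_nonneg _).trans (hR (Classical.arbitrary T))
  have hj : ∀ i z j, |x i z j| ≤ M := fun i z j => (norm_le_pi_norm (x i z) j).trans (hM i z)
  have hB : ∀ i, BddMeas fun z t => x i z ⬝ᵥ δ t := fun i =>
    ⟨measurable_pi_iff.2 fun t => by
      simp only [dotProduct]
      exact Finset.measurable_sum _ fun j _ =>
        (measurable_pi_iff.1 (hx i) j).mul_const _,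
      M * R, fun z t => (abs_dotProduct_le _ _ (hj i z)).trans
        (mul_le_mul_of_nonneg_left (hR t) hM0)⟩
  have e : rad ξ (fun i z t => K * (x i z ⬝ᵥ δ t)) = K * rad ξ fun i z t => x i z ⬝ᵥ δ t :=
    rad_smul ξ hK _
  refine e.le.trans (mul_le_mul_of_nonneg_left ?_ hK)
  -- the dominating variable `max_{j,±} ± ∑ᵢ εᵢ x_{ij}`
  let Mx : (Fin n → W × Bool) → ℝ := fun s =>
    supT fun k : Fin p × Bool => sgn k.2 * ∑ i, sgn (s i).2 * x i (s i).1 k.1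
  have hMx : Integrable Mx (Measure.pi fun i => (ξ i).prod coin) := by
    have : ∀ i, BddMeas fun (s : W × Bool) (k : Fin p × Bool) =>
        sgn k.2 * (sgn s.2 * x i s.1 k.1) := fun i =>
      ⟨measurable_pi_iff.2 fun k => ((measurable_sgn.comp measurable_snd).mul
        ((measurable_pi_iff.1 (hx i) k.1).comp measurable_fst)).const_mul _,
        M, fun s k => by simpa [abs_mul, abs_sgn] using hj i s.1 k.1⟩
    have := (BddMeas.sum this).integrable_supT (Measure.pi fun i => (ξ i).prod coin)
    refine this.congr (ae_of_all _ fun s => ?_)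
    simp only [Mx]
    congr 1 with k
    rw [Finset.sum_apply, Finset.mul_sum]
  have hle : ∀ s j, |∑ i, sgn (s i).2 * x i (s i).1 j| ≤ Mx s := fun s j => by
    refine abs_le'.2 ⟨?_, ?_⟩
    · simpa using le_supT (fun k : Fin p × Bool =>
        sgn k.2 * ∑ i, sgn (s i).2 * x i (s i).1 k.1) (j, true)
    · simpa using le_supT (fun k : Fin p × Bool =>
        sgn k.2 * ∑ i, sgn (s i).2 * x i (s i).1 k.1) (j, false)
  have hMx0 : ∀ s, 0 ≤ Mx s := fun s => (abs_nonneg _).trans (hle s (Classical.arbitrary _))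
  have h1 : rad ξ (fun i z t => x i z ⬝ᵥ δ t) ≤
      ∫ s, R * Mx s ∂Measure.pi fun i => (ξ i).prod coin := by
    refine integral_mono ((BddMeas.sum fun i => (hB i).signed).integrable_supT _)
      (hMx.const_mul R) fun s => supT_le fun t => ?_
    have e2 : (∑ i, signed (fun z t => x i z ⬝ᵥ δ t) (s i)) t =
        (fun j => ∑ i, sgn (s i).2 * x i (s i).1 j) ⬝ᵥ δ t := by
      simp only [Finset.sum_apply, signed, Pi.smul_apply, smul_eq_mul, dotProduct,
        Finset.mul_sum, Finset.sum_mul]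
      rw [Finset.sum_comm]
      simp only [mul_assoc]
    rw [e2]
    refine (le_abs_self _).trans ((abs_dotProduct_le _ _ (hle s)).trans ?_)
    rw [mul_comm]
    exact mul_le_mul_of_nonneg_right (hR t) (hMx0 s)
  refine h1.trans ?_
  rw [integral_const_mul, mul_assoc]
  refine mul_le_mul_of_nonneg_left ?_ hR0
  -- integrate over the signs first, with the covariates fixed
  have mp := (measurePreserving_arrowProdEquivProdArrow W Bool (Fin n) ξ fun _ => coin).symm
  rw [← mp.integral_comp', integral_prod, ← integral_const_mul]
  · refine integral_mono_of_nonneg ?_ ?_ ?_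
    · exact ae_of_all _ fun z => integral_nonneg fun b => hMx0 _
    · refine (Integrable.of_bound (C := √(n * M ^ 2)) (measurable_maxColNorm.comp
        (measurable_pi_iff.2 fun i =>
          (hx i).comp (measurable_pi_apply i))).aestronglyMeasurable
        (ae_of_all _ fun z => ?_)).const_mul _
      rw [Function.comp_apply, Real.norm_of_nonneg (maxColNorm_nonneg _)]
      exact maxColNorm_le fun i => hM i _
    · refine ae_of_all _ fun z => ?_
      exact integral_supT_sgn_sum_le hp fun i => x i (z i)
  · exact mp.integrable_comp_emb (MeasurableEquiv.measurableEmbedding _) |>.2 hMx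

end MaxCol

/-! ### The function `ϱ` -/

section Rho

/-- Up to a constant, `ϱ` is the slope of `ln (1 + ·)` at `0`; so it is analytic at `0`, too. -/
theorem rho_eq_dslope : rho = fun z => dslope (fun z => Real.log (1 + z)) 0 z - 1 := by
  ext z
  rcases eq_or_ne z 0 with rfl | hz
  · have : HasDerivAt (fun z : ℝ => Real.log (1 + z)) 1 0 := by
      simpa using ((hasDerivAt_id (0 : ℝ)).const_add 1).log (by simp)
    simp [rho, dslope_same, this.deriv]
  · simp [rho, hz, dslope_of_ne, slope]

theorem analyticAt_rho {z : ℝ} (hz : -1 < z) : AnalyticAt ℝ rho z := by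
  have hlog : ∀ z : ℝ, -1 < z → AnalyticAt ℝ (fun z => Real.log (1 + z)) z := fun z hz =>
    (analyticAt_const.add analyticAt_id).log (by simp; linarith)
  rcases eq_or_ne z 0 with rfl | h0
  · rw [rho_eq_dslope]
    obtain ⟨q, hq⟩ := hlog 0 hz
    exact (hq.has_fpower_series_dslope_fslope.analyticAt).sub analyticAt_const
  · have : AnalyticAt ℝ (fun z => z⁻¹ * Real.log (1 + z) - 1) z :=
      ((analyticAt_id.inv h0).mul (hlog z hz)).sub analyticAt_const
    refine this.congr ?_
    filter_upwards [isOpen_ne.mem_nhds h0] with w hw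
    simp [rho, show w ≠ 0 from hw]

theorem log_eq_mul_one_add_rho {v : ℝ} : Real.log (1 + v) = v * (1 + rho v) := by
  rcases eq_or_ne v 0 with rfl | h
  · simp
  · simp [rho, h]

theorem measurable_rho : Measurable rho := by
  unfold rho
  exact Measurable.ite (measurableSet_singleton 0) measurable_const (by fun_prop)

variable {Ag Bg : ℝ}

theorem neg_one_lt_sub_one {t : ℝ} (hA : 0 < Ag) (hAB : Ag < Bg)
    (ht : t ∈ Icc (Ag / Bg) (Bg / Ag)) : -1 < t - 1 := by
  have : 0 < Ag / Bg := div_pos hA (hA.trans hAB)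
  linarith [ht.1]

theorem abs_rho_le (hA : 0 < Ag) (hAB : Ag < Bg) {v : ℝ}
    (hv : 1 + v ∈ Icc (Ag / Bg) (Bg / Ag)) : |rho v| ≤ rho0 Ag Bg := by
  have hc : ContinuousOn (fun t => |rho (t - 1)|) (Icc (Ag / Bg) (Bg / Ag)) := fun t ht =>
    (ContinuousAt.comp' (g := rho) (f := fun t : ℝ => t - 1)
      (analyticAt_rho (neg_one_lt_sub_one hA hAB ht)).continuousAt
      (by fun_prop)).abs.continuousWithinAt
  refine le_csSup (isCompact_Icc.image_of_continuousOn hc).bddAbove ⟨1 + v, hv, ?_⟩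
  simp

theorem abs_rho_sub_rho_le (hA : 0 < Ag) (hAB : Ag < Bg) {v w : ℝ}
    (hv : 1 + v ∈ Icc (Ag / Bg) (Bg / Ag)) (hw : 1 + w ∈ Icc (Ag / Bg) (Bg / Ag)) :
    |rho v - rho w| ≤ rho1 Ag Bg * |v - w| := by
  have hc : ContinuousOn (fun t => |deriv rho (t - 1)|) (Icc (Ag / Bg) (Bg / Ag)) := fun t ht =>
    (ContinuousAt.comp' (g := (deriv rho)) (f := fun t : ℝ => t - 1)
      (analyticAt_rho (neg_one_lt_sub_one hA hAB ht)).deriv.continuousAt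
      (by fun_prop)).abs.continuousWithinAt
  have hd : ∀ t ∈ Icc (Ag / Bg) (Bg / Ag),
      HasDerivWithinAt (fun t => rho (t - 1)) (deriv rho (t - 1)) (Icc (Ag / Bg) (Bg / Ag)) t :=
    fun t ht => by
      have := (analyticAt_rho (neg_one_lt_sub_one hA hAB ht)).differentiableAt.hasDerivAt
      exact (HasDerivAt.comp_sub_const t 1 this).hasDerivWithinAt
  have := Convex.norm_image_sub_le_of_norm_hasDerivWithin_le (C := rho1 Ag Bg) hd
    (fun t ht => le_csSup (isCompact_Icc.image_of_continuousOn hc).bddAbove ⟨t, ht, rfl⟩)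
    (convex_Icc _ _) hw hv
  simpa using this

theorem rho0_nonneg : 0 ≤ rho0 Ag Bg :=
  Real.sSup_nonneg (by rintro _ ⟨t, _, rfl⟩; exact abs_nonneg _)

theorem rho1_nonneg : 0 ≤ rho1 Ag Bg :=
  Real.sSup_nonneg (by rintro _ ⟨t, _, rfl⟩; exact abs_nonneg _)

end Rho

/-! ### Link functions with bounded Lipschitz derivative -/

section Link

/-- The assumptions on a link function: values in `[Ag, Bg]` with `0 < Ag < Bg`, and a derivative
that is bounded by `F1` and Lipschitz with constant `F2`. -/
structure LinkBounds (g : ℝ → ℝ) (Ag Bg F1 F2 : ℝ) : Prop where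
  pos : 0 < Ag
  lt : Ag < Bg
  diff : Differentiable ℝ g
  bounds : ∀ t, Ag ≤ g t ∧ g t ≤ Bg
  deriv_le : ∀ t, |deriv g t| ≤ F1
  deriv_lip : ∀ s t, |deriv g t - deriv g s| ≤ F2 * |t - s|

/-- The mean of `g'` on the segment from `a` to `a + s`. Unlike the difference quotient it needs no
convention at `s = 0`. -/
noncomputable def avgDeriv (g : ℝ → ℝ) (a s : ℝ) : ℝ := ∫ τ in (0 : ℝ)..1, deriv g (a + τ * s)

variable {g : ℝ → ℝ} {Ag Bg F1 F2 : ℝ}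

namespace LinkBounds

variable (hg : LinkBounds g Ag Bg F1 F2)
include hg

theorem g_pos (t : ℝ) : 0 < g t := hg.pos.trans_le (hg.bounds t).1

theorem F1_nonneg : 0 ≤ F1 := (abs_nonneg _).trans (hg.deriv_le 0)

theorem F2_nonneg : 0 ≤ F2 := by simpa using (abs_nonneg _).trans (hg.deriv_lip 0 1)

theorem continuous_deriv : Continuous (deriv g) :=
  (LipschitzWith.of_dist_le_mul (K := ⟨F2, hg.F2_nonneg⟩)
    fun t s => hg.deriv_lip s t).continuous

theorem continuous_avgDeriv : Continuous fun q : ℝ × ℝ => avgDeriv g q.1 q.2 := by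
  unfold avgDeriv
  have := hg.continuous_deriv
  exact intervalIntegral.continuous_parametric_intervalIntegral_of_continuous' (by fun_prop) _ _

theorem mul_avgDeriv (a s : ℝ) : s * avgDeriv g a s = g (a + s) - g a := by
  have hd : ∀ τ ∈ uIcc (0 : ℝ) 1,
      HasDerivAt (fun τ => g (a + τ * s)) (s * deriv g (a + τ * s)) τ := fun τ _ => by
      have h := (hg.diff (a + τ * s)).hasDerivAt.comp τ
        (((hasDerivAt_id τ).mul_const s).const_add a)
      exact h.congr_deriv (by simp [mul_comm])
  have hc := hg.continuous_deriv
  have := intervalIntegral.integral_eq_sub_of_hasDerivAt hd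
    (Continuous.intervalIntegrable (by fun_prop) _ _)
  rw [intervalIntegral.integral_const_mul] at this
  simpa [avgDeriv] using this

theorem abs_avgDeriv_le (a s : ℝ) : |avgDeriv g a s| ≤ F1 := by
  have := intervalIntegral.norm_integral_le_of_norm_le_const (a := 0) (b := 1) (C := F1)
    (f := fun τ => deriv g (a + τ * s)) fun τ _ => hg.deriv_le _
  simpa [avgDeriv] using this

theorem abs_avgDeriv_sub_le (a s s' : ℝ) :
    |avgDeriv g a s - avgDeriv g a s'| ≤ F2 / 2 * |s - s'| := by
  have hc := hg.continuous_deriv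
  rw [avgDeriv, avgDeriv, ← intervalIntegral.integral_sub
    (Continuous.intervalIntegrable (by fun_prop) _ _)
    (Continuous.intervalIntegrable (by fun_prop) _ _)]
  have := intervalIntegral.norm_integral_le_of_norm_le (a := 0) (b := 1) zero_le_one
    (f := fun τ => deriv g (a + τ * s) - deriv g (a + τ * s'))
    (g := fun τ => τ * (F2 * |s - s'|)) (μ := volume) (ae_of_all _ fun τ hτ => ?_)
    (Continuous.intervalIntegrable (by fun_prop) _ _)
  · refine this.trans (le_of_eq ?_)
    rw [intervalIntegral.integral_mul_const, integral_id]
    ring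
  · refine (hg.deriv_lip _ _).trans (le_of_eq ?_)
    rw [add_sub_add_left_eq_sub, ← mul_sub, abs_mul, abs_of_pos hτ.1]
    ring

theorem abs_sub_le (s t : ℝ) : |g s - g t| ≤ F1 * |s - t| := by
  have := hg.mul_avgDeriv t (s - t)
  rw [add_sub_cancel] at this
  rw [← this, abs_mul, mul_comm]
  exact mul_le_mul_of_nonneg_right (hg.abs_avgDeriv_le _ _) (abs_nonneg _)

theorem ratio_mem (s t : ℝ) : g s / g t ∈ Icc (Ag / Bg) (Bg / Ag) :=
  ⟨div_le_div₀ (hg.g_pos s).le (hg.bounds s).1 (hg.g_pos t) (hg.bounds t).2,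
    div_le_div₀ (hg.pos.trans hg.lt).le (hg.bounds s).2 hg.pos (hg.bounds t).1⟩

end LinkBounds

end Link

/-! ### Uniform deviation bounds for centred sums -/

section Tails

variable {S T : Type*} [MeasurableSpace S] {n : ℕ} (Q : Fin n → Measure S)
  [∀ i, IsProbabilityMeasure (Q i)]

omit [MeasurableSpace S] in
theorem abs_sum_update_sub_le {F : Fin n → S → ℝ} {b : ℝ} (hb : ∀ i s, |F i s| ≤ b) (i : Fin n)
    (s : Fin n → S) (r : S) :
    |∑ k, F k (s k) - ∑ k, F k (Function.update s i r k)| ≤ 2 * b := by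
  rw [← Finset.sum_sub_distrib, Finset.sum_eq_single i]
  · rw [Function.update_self]
    exact (abs_sub _ _).trans (by linarith [hb i (s i), hb i r])
  · intro j _ hj
    rw [Function.update_of_ne hj, sub_self]
  · simp

/-- Hoeffding's inequality, two-sided. -/
theorem measureReal_abs_sum_sub_integral_lt_le {F : Fin n → S → ℝ} (hF : ∀ i, Measurable (F i))
    {b : ℝ} (hb : ∀ i s, |F i s| ≤ b) {q : ℝ} (hq : 0 < q) (hq1 : q ≤ 1) :
    (Measure.pi Q).real {s | √(2 * n * b ^ 2 * Real.log (2 / q)) <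
      |∑ i, (F i (s i) - ∫ r, F i r ∂Q i)|} ≤ q := by
  have hm : Measurable fun s : Fin n → S => ∑ i, F i (s i) :=
    Finset.measurable_sum _ fun i _ => (hF i).comp (measurable_pi_apply i)
  have hbd : ∀ s : Fin n → S, |∑ i, F i (s i)| ≤ ∑ _i : Fin n, b := fun s =>
    (Finset.abs_sum_le_sum_abs _ _).trans (Finset.sum_le_sum fun i _ => hb i _)
  obtain ⟨c, hc⟩ : ∃ c : ℝ≥0, (c : ℝ) = |2 * b| := ⟨⟨_, abs_nonneg _⟩, rfl⟩
  have key := hasSubgaussianMGF_of_bounded_differences Q hm ⟨_, hbd⟩ (c := fun _ => c)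
    fun i s r => (abs_sum_update_sub_le hb i s r).trans (by rw [hc]; exact le_abs_self _)
  have e : ∫ s, ∑ i, F i (s i) ∂Measure.pi Q = ∑ i, ∫ r, F i r ∂Q i := by
    rw [integral_finsetSum]
    · refine Finset.sum_congr rfl fun i _ => ?_
      have h := integral_map (μ := Measure.pi Q) (measurable_pi_apply i).aemeasurable
        (f := F i) (hF i).aestronglyMeasurable
      rw [(measurePreserving_eval Q i).map_eq] at h
      exact h.symm
    · exact fun i _ => Integrable.of_bound
        ((hF i).comp (measurable_pi_apply i)).aestronglyMeasurable b (ae_of_all _ fun s => hb i _)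
  have hcc : (2 : ℝ) * ((∑ _i : Fin n, (c / 2) ^ 2 : ℝ≥0) : ℝ) * Real.log (1 / (q / 2)) =
      2 * n * b ^ 2 * Real.log (2 / q) := by
    push_cast
    rw [hc, div_pow, sq_abs, one_div_div, Finset.sum_const, Finset.card_univ, Fintype.card_fin,
      nsmul_eq_mul]
    ring
  have h1 := measureReal_lt_le_of_hasSubgaussianMGF key (q := q / 2) (by positivity) (by linarith)
  have h2 := measureReal_lt_le_of_hasSubgaussianMGF key.neg (q := q / 2) (by positivity)
    (by linarith)
  rw [hcc] at h1 h2
  refine (measureReal_mono (s₂ := _ ∪ _) (fun s hs => ?_)).trans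
    ((measureReal_union_le _ _).trans (le_trans (add_le_add h1 h2) (by linarith)))
  simp only [mem_ofPred_eq, Finset.sum_sub_distrib, mem_union, Pi.neg_apply, e] at hs ⊢
  exact lt_abs.1 hs

variable [Fintype T] [Nonempty T]

theorem supT_sub_supT_le {A B : T → ℝ} {c : ℝ} (h : ∀ t, |A t - B t| ≤ c) :
    |supT A - supT B| ≤ c := by
  refine abs_le'.2 ⟨?_, ?_⟩
  · have : supT A ≤ supT B + c := supT_le fun t => by
      linarith [le_supT B t, (abs_le.1 (h t)).2]
    linarith
  · have : supT B ≤ supT A + c := supT_le fun t => by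
      linarith [le_supT A t, (abs_le.1 (h t)).1]
    linarith

/-- A uniform deviation bound for a process that vanishes at some `t₀`. The supremum of `|Xₜ|` is at
most `sup X + sup (-X)`, as both terms are nonnegative; that sum has mean at most `4 rad`, by
symmetrization of each term, and bounded differences `4 b`. -/
theorem measureReal_exists_abs_sum_sub_integral_lt_le {F : Fin n → S → T → ℝ}
    (hF : ∀ i, BddMeas (F i)) {b : ℝ} (hb : ∀ i s t, |F i s t| ≤ b) {t₀ : T}
    (h0 : ∀ i s, F i s t₀ = 0) {q : ℝ} (hq : 0 < q) (hq1 : q ≤ 1) :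
    (Measure.pi Q).real {s | ∃ t, 4 * rad Q F + √(8 * n * b ^ 2 * Real.log (1 / q)) <
      |∑ i, (F i (s i) t - ∫ r, F i r t ∂Q i)|} ≤ q := by
  let m : (Fin n → S → T → ℝ) → Fin n → T → ℝ := fun F i t => ∫ r, F i r t ∂Q i
  let Z : (Fin n → S → T → ℝ) → (Fin n → S) → ℝ := fun F s => supT (∑ i, (F i (s i) - m F i))
  let F' : Fin n → S → T → ℝ := fun i s => -F i s
  have hF' : ∀ i, BddMeas (F' i) := fun i => (hF i).neg
  have hb' : ∀ i s t, |F' i s t| ≤ b := fun i s t => by simpa [F'] using hb i s t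
  have hcent : ∀ {G : Fin n → S → T → ℝ}, (∀ i, BddMeas (G i)) →
      BddMeas fun s : Fin n → S => ∑ i, (G i (s i) - m G i) := by
    intro G hG
    refine BddMeas.sum (F := fun i s => G i s - m G i) fun i => ⟨(hG i).meas.sub_const _, ?_⟩
    obtain ⟨C, hC⟩ := (hG i).bdd
    exact ⟨C + C, fun s t => (abs_sub _ _).trans (add_le_add (hC s t)
      (abs_integral_le_of_forall_abs_le fun r => hC r t))⟩
  have hZm : ∀ {G : Fin n → S → T → ℝ}, (∀ i, BddMeas (G i)) → Measurable (Z G) := fun hG =>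
    (supLike_supT (T := T)).lip.continuous.measurable.comp (hcent hG).meas
  have hZb : ∀ {G : Fin n → S → T → ℝ}, (∀ i, BddMeas (G i)) → ∃ C, ∀ s, |Z G s| ≤ C := by
    intro G hG
    obtain ⟨C, _, hC⟩ := (hcent hG).exists_norm_le
    refine ⟨_, fun s => ((supLike_supT (T := T)).abs_le _).trans (add_le_add le_rfl (hC s))⟩
  have hZd : ∀ {G : Fin n → S → T → ℝ}, (∀ i s t, |G i s t| ≤ b) → ∀ i s r,
      |Z G s - Z G (Function.update s i r)| ≤ 2 * b := by
    intro G hG i s r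
    refine supT_sub_supT_le fun t => ?_
    have := abs_sum_update_sub_le (F := fun i s => G i s t) (fun i s => hG i s t) i s r
    simp only [Finset.sum_apply, Pi.sub_apply, Finset.sum_sub_distrib]
    rwa [sub_sub_sub_cancel_right]
  have hZI : ∀ {G : Fin n → S → T → ℝ}, (∀ i, BddMeas (G i)) → Integrable (Z G) (Measure.pi Q) :=
    fun hG => (hcent hG).integrable_supT _
  obtain ⟨c, hc⟩ : ∃ c : ℝ≥0, (c : ℝ) = |4 * b| := ⟨⟨_, abs_nonneg _⟩, rfl⟩
  have key := hasSubgaussianMGF_of_bounded_differences Q (f := fun s => Z F s + Z F' s)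
    ((hZm hF).add (hZm hF'))
    (by
      obtain ⟨C, hC⟩ := hZb hF
      obtain ⟨C', hC'⟩ := hZb hF'
      exact ⟨C + C', fun s => (abs_add_le _ _).trans (add_le_add (hC s) (hC' s))⟩)
    (c := fun _ => c) fun i s r => by
      rw [add_sub_add_comm, hc]
      refine (abs_add_le _ _).trans ((add_le_add (hZd hb i s r) (hZd hb' i s r)).trans ?_)
      exact le_trans (by linarith) (le_abs_self _)
  have hE : ∫ s, (Z F s + Z F' s) ∂Measure.pi Q ≤ 4 * rad Q F := by
    rw [integral_add (hZI hF) (hZI hF')]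
    have h1 : ∫ s, Z F s ∂Measure.pi Q ≤ 2 * rad Q F :=
      (integral_supT_sum_sub_integral_le Q hF).trans (rad_smul Q (by norm_num) F).le
    have h2 : ∫ s, Z F' s ∂Measure.pi Q ≤ 2 * rad Q F' :=
      (integral_supT_sum_sub_integral_le Q hF').trans (rad_smul Q (by norm_num) F').le
    have h3 : rad Q F' ≤ rad Q F := rad_le_of_abs_sub_le Q hF' hF fun i s t t' => by
      simp only [F', Pi.neg_apply]
      rw [neg_sub_neg, abs_sub_comm]
    linarith
  have hcc : (2 : ℝ) * ((∑ _i : Fin n, (c / 2) ^ 2 : ℝ≥0) : ℝ) * Real.log (1 / q) =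
      8 * n * b ^ 2 * Real.log (1 / q) := by
    push_cast
    rw [hc, div_pow, sq_abs, Finset.sum_const, Finset.card_univ, Fintype.card_fin, nsmul_eq_mul]
    ring
  have h1 := measureReal_lt_le_of_hasSubgaussianMGF key hq hq1
  rw [hcc] at h1
  refine (measureReal_mono fun s hs => ?_).trans h1
  obtain ⟨t, ht⟩ := hs
  have hz : ∀ {G : Fin n → S → T → ℝ}, (∀ i s, G i s t₀ = 0) → 0 ≤ Z G s := fun {G} h => by
    refine le_of_eq_of_le ?_ (le_supT (∑ i, (G i (s i) - m G i)) t₀)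
    simp [m, h]
  have hzF := hz h0
  have hzF' := hz (G := F') fun i s => by simp [F', h0]
  have hle : |∑ i, (F i (s i) t - ∫ r, F i r t ∂Q i)| ≤ Z F s + Z F' s := by
    refine abs_le'.2 ⟨?_, ?_⟩
    · have := le_supT (∑ i, (F i (s i) - m F i)) t
      simp only [Finset.sum_apply, Pi.sub_apply] at this
      exact this.trans (le_add_of_nonneg_right hzF')
    · have h := le_supT (∑ i, (F' i (s i) - m F' i)) t
      have e : (∑ i, (F' i (s i) - m F' i)) t = -∑ i, (F i (s i) t - ∫ r, F i r t ∂Q i) := by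
        simp only [Finset.sum_apply, Pi.sub_apply, F', m, Pi.neg_apply, integral_neg,
          ← Finset.sum_neg_distrib]
        exact Finset.sum_congr rfl fun i _ => by ring
      rw [e] at h
      exact h.trans (le_add_of_nonneg_left hzF)
  simp only [mem_ofPred_eq]
  linarith

end Tails

/-! ### Increments of the density ratio -/

section Remainder

variable {W : Type*} {p : ℕ}

/-- The difference quotient of `g` between `a` and `a + s`, relative to `g a`; at `s = 0` it is the
logarithmic derivative of `g` at `a`. -/
noncomputable def relSlope (g : ℝ → ℝ) (a s : ℝ) : ℝ := avgDeriv g a s / g a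

/-- The increment `g(x(z)ᵀ(θ+δ)) / g(x(z)ᵀθ) - 1` of the density ratio. -/
noncomputable def ratioInc (g : ℝ → ℝ) (x : W → Fin p → ℝ) (θ δ : Fin p → ℝ) (z : W) : ℝ :=
  g (x z ⬝ᵥ (θ + δ)) / g (x z ⬝ᵥ θ) - 1

/-- The `j`-th component of the score `∇ ln g(x(z)ᵀθ)` of the hidden variable. -/
noncomputable def scoreAt (g : ℝ → ℝ) (x : W → Fin p → ℝ) (θ : Fin p → ℝ) (j : Fin p) (z : W) : ℝ :=
  x z j * relSlope g (x z ⬝ᵥ θ) 0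

/-- The covariate `x_j(z)` times the change of the relative slope of `g` at `x(z)ᵀθ` as the step
grows from `0` to `x(z)ᵀδ`. -/
noncomputable def scoreInc (g : ℝ → ℝ) (x : W → Fin p → ℝ) (θ : Fin p → ℝ) (j : Fin p)
    (δ : Fin p → ℝ) (z : W) : ℝ :=
  x z j * (relSlope g (x z ⬝ᵥ θ) (x z ⬝ᵥ δ) - relSlope g (x z ⬝ᵥ θ) 0)

variable {g : ℝ → ℝ} {Ag Bg F1 F2 MX R : ℝ}

theorem abs_apply_le_of_norm_le {x : W → Fin p → ℝ} (hM : ∀ z, ‖x z‖ ≤ MX) (z : W) (j : Fin p) :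
    |x z j| ≤ MX :=
  (norm_le_pi_norm (x z) j).trans (hM z)

theorem psi1_nonneg (hg : LinkBounds g Ag Bg F1 F2) : 0 ≤ psi1 Ag F1 :=
  div_nonneg hg.F1_nonneg hg.pos.le

theorem psi2_nonneg (hg : LinkBounds g Ag Bg F1 F2) (hM : 0 < MX) : 0 ≤ psi2 Ag F2 MX :=
  div_nonneg (mul_nonneg hg.F2_nonneg hM.le) (by linarith [hg.pos])

theorem psi3_nonneg (hg : LinkBounds g Ag Bg F1 F2) (hM : 0 < MX) (hR : 0 ≤ R) :
    0 ≤ psi3 Ag F1 F2 MX R := by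
  have := hg.F1_nonneg
  have := hg.F2_nonneg
  exact div_nonneg (le_min (by positivity) (by positivity)) hg.pos.le

namespace LinkBounds

variable (hg : LinkBounds g Ag Bg F1 F2)
include hg

theorem abs_relSlope_le (a s : ℝ) : |relSlope g a s| ≤ psi1 Ag F1 := by
  rw [relSlope, abs_div, abs_of_pos (hg.g_pos a)]
  exact div_le_div₀ hg.F1_nonneg (hg.abs_avgDeriv_le _ _) hg.pos (hg.bounds a).1

theorem abs_relSlope_sub_le (a s s' : ℝ) :
    |relSlope g a s - relSlope g a s'| ≤ F2 / (2 * Ag) * |s - s'| := by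
  rw [relSlope, relSlope, ← sub_div, abs_div, abs_of_pos (hg.g_pos a)]
  have := hg.F2_nonneg
  refine (div_le_div₀ (by positivity) (hg.abs_avgDeriv_sub_le a s s') hg.pos
    (hg.bounds a).1).trans (le_of_eq ?_)
  have := hg.pos
  field_simp

theorem ratioInc_eq (x : W → Fin p → ℝ) (θ δ : Fin p → ℝ) (z : W) :
    ratioInc g x θ δ z = x z ⬝ᵥ δ * relSlope g (x z ⬝ᵥ θ) (x z ⬝ᵥ δ) := by
  rw [relSlope, ← mul_div_assoc, hg.mul_avgDeriv, sub_div, div_self (hg.g_pos _).ne', ratioInc,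
    dotProduct_add]

theorem one_add_ratioInc_mem (x : W → Fin p → ℝ) (θ δ : Fin p → ℝ) (z : W) :
    1 + ratioInc g x θ δ z ∈ Icc (Ag / Bg) (Bg / Ag) := by
  rw [ratioInc, add_sub_cancel]
  exact hg.ratio_mem _ _

theorem abs_ratioInc_sub_le (x : W → Fin p → ℝ) (θ δ δ' : Fin p → ℝ) (z : W) :
    |ratioInc g x θ δ z - ratioInc g x θ δ' z| ≤ psi1 Ag F1 * |x z ⬝ᵥ δ - x z ⬝ᵥ δ'| := by
  rw [ratioInc, ratioInc, sub_sub_sub_cancel_right, ← sub_div, abs_div, abs_of_pos (hg.g_pos _),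
    psi1, div_mul_eq_mul_div]
  have := hg.F1_nonneg
  refine div_le_div₀ (by positivity) ((hg.abs_sub_le _ _).trans (le_of_eq ?_)) hg.pos
    (hg.bounds _).1
  simp [dotProduct_add]

theorem measurable_ratioInc [MeasurableSpace W] {x : W → Fin p → ℝ} (hx : Measurable x)
    (θ δ : Fin p → ℝ) : Measurable (ratioInc g x θ δ) := by
  have := hg.diff.continuous.measurable
  unfold ratioInc dotProduct
  fun_prop

theorem measurable_scoreAt [MeasurableSpace W] {x : W → Fin p → ℝ} (hx : Measurable x)
    (θ : Fin p → ℝ) (j : Fin p) : Measurable (scoreAt g x θ j) := by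
  have h1 := hg.diff.continuous.measurable
  have h2 : Measurable fun z => avgDeriv g (x z ⬝ᵥ θ) 0 :=
    hg.continuous_avgDeriv.measurable.comp (f := fun z => (x z ⬝ᵥ θ, (0 : ℝ)))
      (by unfold dotProduct; fun_prop)
  have h3 : Measurable fun z => g (x z ⬝ᵥ θ) := by unfold dotProduct; fun_prop
  unfold scoreAt relSlope
  fun_prop

theorem measurable_scoreInc [MeasurableSpace W] {x : W → Fin p → ℝ} (hx : Measurable x)
    (θ : Fin p → ℝ) (j : Fin p) (δ : Fin p → ℝ) : Measurable (scoreInc g x θ j δ) := by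
  have h1 := hg.diff.continuous.measurable
  have h2 : ∀ δ : Fin p → ℝ, Measurable fun z => avgDeriv g (x z ⬝ᵥ θ) (x z ⬝ᵥ δ) := fun δ =>
    hg.continuous_avgDeriv.measurable.comp (f := fun z => (x z ⬝ᵥ θ, x z ⬝ᵥ δ))
      (by unfold dotProduct; fun_prop)
  have h4 := h2 0
  simp only [dotProduct_zero] at h4
  have h3 : Measurable fun z => g (x z ⬝ᵥ θ) := by unfold dotProduct; fun_prop
  have h5 := h2 δ
  unfold scoreInc relSlope
  fun_prop

variable {x : W → Fin p → ℝ} (hM : ∀ z, ‖x z‖ ≤ MX)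
include hM

theorem abs_scoreAt_le (θ : Fin p → ℝ) (j : Fin p) (z : W) :
    |scoreAt g x θ j z| ≤ psi1 Ag F1 * MX := by
  rw [scoreAt, abs_mul, mul_comm]
  exact mul_le_mul (hg.abs_relSlope_le _ _) (abs_apply_le_of_norm_le hM z j) (abs_nonneg _)
    (psi1_nonneg hg)

theorem abs_scoreInc_le (hM0 : 0 < MX) (θ : Fin p → ℝ) (j : Fin p) {δ : Fin p → ℝ}
    (hδ : l1norm δ ≤ R) (z : W) : |scoreInc g x θ j δ z| ≤ psi3 Ag F1 F2 MX R * MX := by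
  have hR : 0 ≤ R := (l1norm_nonneg δ).trans hδ
  rw [scoreInc, abs_mul, mul_comm]
  refine mul_le_mul ?_ (abs_apply_le_of_norm_le hM z j) (abs_nonneg _) (psi3_nonneg hg hM0 hR)
  rw [psi3, le_div_iff₀ hg.pos]
  have hA := hg.pos
  refine le_min ?_ ?_
  · have := (abs_sub _ _).trans (add_le_add (hg.abs_relSlope_le (x z ⬝ᵥ θ) (x z ⬝ᵥ δ))
      (hg.abs_relSlope_le (x z ⬝ᵥ θ) 0))
    rw [psi1, ← add_div, le_div_iff₀ hA] at this
    linarith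
  · have h1 := hg.abs_relSlope_sub_le (x z ⬝ᵥ θ) (x z ⬝ᵥ δ) 0
    rw [sub_zero] at h1
    have h2 : |x z ⬝ᵥ δ| ≤ MX * R :=
      (abs_dotProduct_le _ _ (abs_apply_le_of_norm_le hM z)).trans
        (mul_le_mul_of_nonneg_left hδ hM0.le)
    have := hg.F2_nonneg
    calc _ ≤ F2 / (2 * Ag) * (MX * R) * Ag := by gcongr; exact h1.trans (by gcongr)
      _ = F2 * MX * R / 2 := by field_simp

theorem abs_scoreInc_sub_le (θ : Fin p → ℝ) (j : Fin p) (δ δ' : Fin p → ℝ) (z : W) :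
    |scoreInc g x θ j δ z - scoreInc g x θ j δ' z| ≤
      psi2 Ag F2 MX * |x z ⬝ᵥ δ - x z ⬝ᵥ δ'| := by
  rw [scoreInc, scoreInc, ← mul_sub, sub_sub_sub_cancel_right, abs_mul]
  have h0 : 0 ≤ MX := (norm_nonneg _).trans (hM z)
  refine (mul_le_mul (abs_apply_le_of_norm_le hM z j) (hg.abs_relSlope_sub_le _ _ _)
    (abs_nonneg _) h0).trans (le_of_eq ?_)
  rw [psi2]
  ring

omit hM

/-- The density ratio is affine in `δ` up to the terms `scoreInc`, coordinate by coordinate. -/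
theorem ratioInc_eq_sum (θ δ : Fin p → ℝ) (z : W) : ratioInc g x θ δ z =
    ∑ j, δ j * (scoreAt g x θ j z + scoreInc g x θ j δ z) := by
  rw [hg.ratioInc_eq]
  nth_rw 1 [dotProduct]
  rw [Finset.sum_mul]
  refine Finset.sum_congr rfl fun j _ => ?_
  rw [scoreAt, scoreInc]
  ring

end LinkBounds

end Remainder

/-! ### Posterior means and the decomposition of the log-ratio -/

section Conditional

variable {W 𝒴 : Type*} [MeasurableSpace W] [MeasurableSpace 𝒴] {p : ℕ}

/-- The posterior mean of `ratioInc`, where `κ y` is the law of the hidden variable given `y`. -/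
noncomputable def condRatio (κ : Kernel 𝒴 W) (g : ℝ → ℝ) (x : W → Fin p → ℝ) (θ δ : Fin p → ℝ)
    (y : 𝒴) : ℝ := ∫ z, ratioInc g x θ δ z ∂κ y

/-- The posterior mean of `scoreAt`: the `j`-th component of the score of the observation. -/
noncomputable def condScore (κ : Kernel 𝒴 W) (g : ℝ → ℝ) (x : W → Fin p → ℝ) (θ : Fin p → ℝ)
    (j : Fin p) (y : 𝒴) : ℝ := ∫ z, scoreAt g x θ j z ∂κ y

/-- The posterior mean of `scoreInc`. -/
noncomputable def condScoreInc (κ : Kernel 𝒴 W) (g : ℝ → ℝ) (x : W → Fin p → ℝ) (θ : Fin p → ℝ)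
    (j : Fin p) (δ : Fin p → ℝ) (y : 𝒴) : ℝ := ∫ z, scoreInc g x θ j δ z ∂κ y

/-- The `j`-th coefficient of the log-ratio minus its value `condScore` at `δ = 0`. With `a =
condScore`, `w = condScoreInc` and `v = condRatio` it is `w + (a + w) ϱ(v)`. -/
noncomputable def remainder (κ : Kernel 𝒴 W) (g : ℝ → ℝ) (x : W → Fin p → ℝ) (θ : Fin p → ℝ)
    (j : Fin p) (δ : Fin p → ℝ) (y : 𝒴) : ℝ :=
  condScoreInc κ g x θ j δ y +
    (condScore κ g x θ j y * rho (condRatio κ g x θ δ y) +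
      condScoreInc κ g x θ j δ y * rho (condRatio κ g x θ δ y))

variable {g : ℝ → ℝ} {Ag Bg F1 F2 MX R : ℝ}

namespace LinkBounds

variable (hg : LinkBounds g Ag Bg F1 F2)
include hg

omit [MeasurableSpace W] in
theorem abs_ratioInc_le (x : W → Fin p → ℝ) (θ δ : Fin p → ℝ) (z : W) :
    |ratioInc g x θ δ z| ≤ 1 + Bg / Ag := by
  have h := hg.one_add_ratioInc_mem x θ δ z
  have := div_pos hg.pos (hg.pos.trans hg.lt)
  exact abs_le.2 ⟨by linarith [h.1, h.2], by linarith [h.2]⟩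

variable {x : W → Fin p → ℝ} (hx : Measurable x)
include hx

theorem bddMeas_ratioInc {T : Type*} (θ : Fin p → ℝ) (δ : T → Fin p → ℝ) :
    BddMeas fun z t => ratioInc g x θ (δ t) z :=
  ⟨measurable_pi_iff.2 fun t => hg.measurable_ratioInc hx θ (δ t), _,
    fun z t => hg.abs_ratioInc_le x θ (δ t) z⟩

theorem integrable_ratioInc (Q : Measure W) [IsFiniteMeasure Q] (θ δ : Fin p → ℝ) :
    Integrable (ratioInc g x θ δ) Q :=
  (hg.bddMeas_ratioInc hx θ (fun _ : Unit => δ)).integrable Q ()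

variable (κ : Kernel 𝒴 W)

theorem measurable_condRatio (θ δ : Fin p → ℝ) : Measurable (condRatio κ g x θ δ) :=
  ((hg.measurable_ratioInc hx θ δ).stronglyMeasurable.integral_kernel (κ := κ)).measurable

theorem measurable_condScore (θ : Fin p → ℝ) (j : Fin p) : Measurable (condScore κ g x θ j) :=
  ((hg.measurable_scoreAt hx θ j).stronglyMeasurable.integral_kernel (κ := κ)).measurable

theorem measurable_condScoreInc (θ : Fin p → ℝ) (j : Fin p) (δ : Fin p → ℝ) :
    Measurable (condScoreInc κ g x θ j δ) :=
  ((hg.measurable_scoreInc hx θ j δ).stronglyMeasurable.integral_kernel (κ := κ)).measurable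

theorem measurable_remainder (θ : Fin p → ℝ) (j : Fin p) (δ : Fin p → ℝ) :
    Measurable (remainder κ g x θ j δ) := by
  have h1 := hg.measurable_condRatio hx κ θ δ
  have h2 := hg.measurable_condScore hx κ θ j
  have h3 := hg.measurable_condScoreInc hx κ θ j δ
  have h4 := measurable_rho
  unfold remainder
  fun_prop

omit hx in
theorem condRatio_zero (θ : Fin p → ℝ) (y : 𝒴) : condRatio κ g x θ 0 y = 0 := by
  simp [condRatio, ratioInc, div_self (hg.g_pos _).ne']

omit hx in
theorem remainder_zero (θ : Fin p → ℝ) (j : Fin p) (y : 𝒴) : remainder κ g x θ j 0 y = 0 := by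
  have h : condScoreInc κ g x θ j 0 y = 0 := by simp [condScoreInc, scoreInc]
  simp [remainder, hg.condRatio_zero, h, rho]

variable [IsMarkovKernel κ]

theorem one_add_condRatio_eq (θ δ : Fin p → ℝ) (y : 𝒴) :
    1 + condRatio κ g x θ δ y = ∫ z, g (x z ⬝ᵥ (θ + δ)) / g (x z ⬝ᵥ θ) ∂κ y := by
  have : (fun z => g (x z ⬝ᵥ (θ + δ)) / g (x z ⬝ᵥ θ)) = fun z => 1 + ratioInc g x θ δ z := by
    ext z; rw [ratioInc, add_sub_cancel]
  rw [this, integral_add (integrable_const _) (hg.integrable_ratioInc hx _ θ δ)]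
  simp [condRatio]

theorem one_add_condRatio_mem (θ δ : Fin p → ℝ) (y : 𝒴) :
    1 + condRatio κ g x θ δ y ∈ Icc (Ag / Bg) (Bg / Ag) := by
  rw [hg.one_add_condRatio_eq hx]
  refine (convex_Icc _ _).integral_mem isClosed_Icc (ae_of_all _ fun z => hg.ratio_mem _ _) ?_
  have : (fun z => g (x z ⬝ᵥ (θ + δ)) / g (x z ⬝ᵥ θ)) = fun z => 1 + ratioInc g x θ δ z := by
    ext z; rw [ratioInc, add_sub_cancel]
  rw [this]
  exact (integrable_const _).add (hg.integrable_ratioInc hx _ θ δ)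

theorem one_add_condRatio_pos (θ δ : Fin p → ℝ) (y : 𝒴) : 0 < 1 + condRatio κ g x θ δ y :=
  (div_pos hg.pos (hg.pos.trans hg.lt)).trans_le (hg.one_add_condRatio_mem hx κ θ δ y).1

variable (hM : ∀ z, ‖x z‖ ≤ MX) (hM0 : 0 < MX)
include hM hM0

omit hM0 hx in
theorem abs_condScore_le (θ : Fin p → ℝ) (j : Fin p) (y : 𝒴) :
    |condScore κ g x θ j y| ≤ psi1 Ag F1 * MX :=
  abs_integral_le_of_forall_abs_le fun z => hg.abs_scoreAt_le hM θ j z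

omit hx in
theorem abs_condScoreInc_le (θ : Fin p → ℝ) (j : Fin p) {δ : Fin p → ℝ} (hδ : l1norm δ ≤ R)
    (y : 𝒴) : |condScoreInc κ g x θ j δ y| ≤ psi3 Ag F1 F2 MX R * MX :=
  abs_integral_le_of_forall_abs_le fun z => hg.abs_scoreInc_le hM hM0 θ j hδ z

theorem abs_remainder_le (θ : Fin p → ℝ) (j : Fin p) {δ : Fin p → ℝ} (hδ : l1norm δ ≤ R)
    (y : 𝒴) : |remainder κ g x θ j δ y| ≤ psi4 Ag Bg F1 F2 MX R := by
  have h1 := hg.abs_condScore_le κ hM θ j y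
  have h2 := hg.abs_condScoreInc_le κ hM hM0 θ j hδ y
  have h3 := abs_rho_le hg.pos hg.lt (hg.one_add_condRatio_mem hx κ θ δ y)
  have h4 := mul_le_mul h1 h3 (abs_nonneg _) ((abs_nonneg _).trans h1)
  have h5 := mul_le_mul h2 h3 (abs_nonneg _) ((abs_nonneg _).trans h2)
  rw [← abs_mul] at h4 h5
  refine (abs_add_le _ _).trans ((add_le_add h2 ((abs_add_le _ _).trans
    (add_le_add h4 h5))).trans (le_of_eq ?_))
  rw [psi4]
  ring

/-- The decomposition of the log-ratio into a linear part and remainders, coordinate by coordinate: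
with `v = ∑ⱼ δⱼ (aⱼ + wⱼ)` it is `ln (1 + v) = v (1 + ϱ(v))`. -/
theorem log_one_add_condRatio (θ δ : Fin p → ℝ) (y : 𝒴) :
    Real.log (1 + condRatio κ g x θ δ y) =
      ∑ j, δ j * (condScore κ g x θ j y + remainder κ g x θ j δ y) := by
  have e : condRatio κ g x θ δ y =
      ∑ j, δ j * (condScore κ g x θ j y + condScoreInc κ g x θ j δ y) := by
    have I1 : ∀ j, Integrable (scoreAt g x θ j) (κ y) := fun j =>
      Integrable.of_bound (hg.measurable_scoreAt hx θ j).aestronglyMeasurable _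
        (ae_of_all _ fun z => hg.abs_scoreAt_le hM θ j z)
    have I2 : ∀ j, Integrable (scoreInc g x θ j δ) (κ y) := fun j =>
      Integrable.of_bound (hg.measurable_scoreInc hx θ j δ).aestronglyMeasurable _
        (ae_of_all _ fun z => hg.abs_scoreInc_le hM hM0 θ j le_rfl z)
    simp only [condRatio, hg.ratioInc_eq_sum]
    have I12 : ∀ j, Integrable (fun z => δ j * (scoreAt g x θ j z + scoreInc g x θ j δ z)) (κ y) :=
      fun j => ((I1 j).add (I2 j)).const_mul _
    rw [integral_finsetSum _ fun j _ => I12 j]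
    refine Finset.sum_congr rfl fun j _ => ?_
    rw [integral_const_mul, integral_add (I1 j) (I2 j), condScore, condScoreInc]
  rw [log_eq_mul_one_add_rho]
  nth_rw 1 [e]
  rw [Finset.sum_mul]
  refine Finset.sum_congr rfl fun j _ => ?_
  rw [remainder]
  ring

omit hM hM0 in
theorem continuous_condRatio (θ : Fin p → ℝ) (y : 𝒴) :
    Continuous fun δ => condRatio κ g x θ δ y := by
  refine continuous_of_dominated (F := fun δ z => ratioInc g x θ δ z)
    (bound := fun _ => 1 + Bg / Ag)
    (fun δ => (hg.measurable_ratioInc hx θ δ).aestronglyMeasurable)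
    (fun δ => ae_of_all _ fun z => hg.abs_ratioInc_le x θ δ z) (integrable_const _)
    (ae_of_all _ fun z => ?_)
  have := hg.diff.continuous
  unfold ratioInc dotProduct
  fun_prop

omit hM hM0 in
theorem continuous_log_condRatio (θ : Fin p → ℝ) (y : 𝒴) :
    Continuous fun δ => Real.log (1 + condRatio κ g x θ δ y) :=
  (continuous_const.add (hg.continuous_condRatio hx κ θ y)).log fun δ =>
    (hg.one_add_condRatio_pos hx κ θ δ y).ne'

omit hM hM0 in
theorem abs_log_condRatio_le (θ δ : Fin p → ℝ) (y : 𝒴) :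
    |Real.log (1 + condRatio κ g x θ δ y)| ≤ Real.log (Bg / Ag) := by
  have h := hg.one_add_condRatio_mem hx κ θ δ y
  have hpos := hg.one_add_condRatio_pos hx κ θ δ y
  have hB := hg.pos.trans hg.lt
  refine abs_le.2 ⟨?_, Real.log_le_log hpos h.2⟩
  rw [← Real.log_inv, inv_div]
  exact Real.log_le_log (div_pos hg.pos hB) h.1

omit hM hM0 in
theorem continuous_integral_log_condRatio (ρ : Measure 𝒴) [IsFiniteMeasure ρ] (θ : Fin p → ℝ) :
    Continuous fun δ => ∫ y, Real.log (1 + condRatio κ g x θ δ y) ∂ρ :=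
  continuous_of_dominated (bound := fun _ => Real.log (Bg / Ag))
    (fun δ => (by
      have := hg.measurable_condRatio hx κ θ δ
      exact Measurable.aestronglyMeasurable (by fun_prop)))
    (fun δ => ae_of_all _ fun y => hg.abs_log_condRatio_le hx κ θ δ y) (integrable_const _)
    (ae_of_all _ fun y => hg.continuous_log_condRatio hx κ θ y)

end LinkBounds

end Conditional

/-! ### The Rademacher average of the remainder -/

section RadRemainder

variable {W 𝒴 T : Type*} [MeasurableSpace W] [MeasurableSpace 𝒴] [Fintype T] [Nonempty T]
  {n p : ℕ} {g : Fin n → ℝ → ℝ} {Ag Bg F1 F2 MX R : ℝ} {x : Fin n → W → Fin p → ℝ}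
  (ρ : Fin n → Measure 𝒴) [∀ i, IsProbabilityMeasure (ρ i)]
  (κ : Fin n → Kernel 𝒴 W) [∀ i, IsMarkovKernel (κ i)]

/-- The increments of `w` and of `v` are posterior means of functions that are Lipschitz in `⟨x, δ⟩`
with constants `ψ₂` and `ψ₁`. For `a ϱ(v)` the contraction principle applies, with `|a| ≤ ψ₁ M_X`
and `ϱ` Lipschitz with constant `ϱ₁`. The product `w ϱ(v)` of two processes needs the
two-dimensional contraction principle. -/
theorem rad_remainder_le (hn : 0 < n) (hp : 0 < p) (hg : ∀ i, LinkBounds (g i) Ag Bg F1 F2)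
    (hx : ∀ i, Measurable (x i)) (hM : ∀ i z, ‖x i z‖ ≤ MX) (hM0 : 0 < MX) (θ : Fin p → ℝ)
    {δ : T → Fin p → ℝ} (hδ : ∀ t, l1norm (δ t) ≤ R) (j : Fin p) :
    rad ρ (fun i y t => remainder (κ i) (g i) (x i) θ j (δ t) y) ≤
      (psi2 Ag F2 MX * (1 + 2 * rho0 Ag Bg) +
        psi1 Ag F1 * MX * rho1 Ag Bg * (psi1 Ag F1 + 2 * psi3 Ag F1 F2 MX R)) *
      (R * √(2 * Real.log (2 * p)) *
        ∫ z, maxColNorm (fun i => x i (z i)) ∂Measure.pi fun i => κ i ∘ₘ ρ i) := by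
  have hg0 := hg ⟨0, hn⟩
  have hR : 0 ≤ R := (l1norm_nonneg _).trans (hδ (Classical.arbitrary T))
  have hψ1 := psi1_nonneg hg0
  have hψ2 := psi2_nonneg hg0 hM0
  have hψ3 := psi3_nonneg hg0 hM0 hR
  have hρ0 := rho0_nonneg (Ag := Ag) (Bg := Bg)
  have hρ1 := rho1_nonneg (Ag := Ag) (Bg := Bg)
  set E := R * √(2 * Real.log (2 * p)) *
        ∫ z, maxColNorm (fun i => x i (z i)) ∂Measure.pi fun i => κ i ∘ₘ ρ i
  -- the processes on the space of observations
  let w : Fin n → 𝒴 → T → ℝ := fun i y t => condScoreInc (κ i) (g i) (x i) θ j (δ t) y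
  let v : Fin n → 𝒴 → T → ℝ := fun i y t => condRatio (κ i) (g i) (x i) θ (δ t) y
  let a : Fin n → 𝒴 → ℝ := fun i y => condScore (κ i) (g i) (x i) θ j y
  have hw : ∀ i y t, |w i y t| ≤ psi3 Ag F1 F2 MX R * MX := fun i y t =>
    (hg i).abs_condScoreInc_le (κ i) (hM i) hM0 θ j (hδ t) y
  have ha : ∀ i y, |a i y| ≤ psi1 Ag F1 * MX := fun i y =>
    (hg i).abs_condScore_le (κ i) (hM i) θ j y
  have hv : ∀ i y t, 1 + v i y t ∈ Icc (Ag / Bg) (Bg / Ag) := fun i y t =>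
    (hg i).one_add_condRatio_mem (hx i) (κ i) θ (δ t) y
  have hr : ∀ i y t, |rho (v i y t)| ≤ rho0 Ag Bg := fun i y t =>
    abs_rho_le hg0.pos hg0.lt (hv i y t)
  have mv : ∀ i t, Measurable fun y => v i y t := fun i t =>
    (hg i).measurable_condRatio (hx i) (κ i) θ (δ t)
  have mw : ∀ i t, Measurable fun y => w i y t := fun i t =>
    (hg i).measurable_condScoreInc (hx i) (κ i) θ j (δ t)
  have ma : ∀ i, Measurable (a i) := fun i => (hg i).measurable_condScore (hx i) (κ i) θ j
  have mr := measurable_rho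
  have Bw : ∀ i, BddMeas (w i) := fun i => ⟨measurable_pi_iff.2 (mw i), _, hw i⟩
  have BvW := fun i => (hg i).bddMeas_ratioInc (hx i) θ δ
  have Bv : ∀ i, BddMeas (v i) := fun i => (BvW i).integral_kernel (κ i)
  have BwW : ∀ i, BddMeas fun z t => scoreInc (g i) (x i) θ j (δ t) z := fun i =>
    ⟨measurable_pi_iff.2 fun t => (hg i).measurable_scoreInc (hx i) θ j (δ t), _,
      fun z t => (hg i).abs_scoreInc_le (hM i) hM0 θ j (hδ t) z⟩
  have Bar : ∀ i, BddMeas fun y t => a i y * rho (v i y t) := fun i =>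
    ⟨measurable_pi_iff.2 fun t => (ma i).mul (mr.comp (mv i t)), _, fun y t => by
      rw [abs_mul]
      exact mul_le_mul (ha i y) (hr i y t) (abs_nonneg _) (by positivity)⟩
  have Bwr : ∀ i, BddMeas fun y t => w i y t * rho (v i y t) := fun i =>
    ⟨measurable_pi_iff.2 fun t => (mw i t).mul (mr.comp (mv i t)), _, fun y t => by
      rw [abs_mul]
      exact mul_le_mul (hw i y t) (hr i y t) (abs_nonneg _) (by positivity)⟩
  have BxW : ∀ i, BddMeas fun z t => x i z ⬝ᵥ δ t := fun i =>
    ⟨measurable_pi_iff.2 fun t => by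
      have := hx i
      unfold dotProduct
      fun_prop, MX * R, fun z t =>
        (abs_dotProduct_le _ _ (abs_apply_le_of_norm_le (hM i) z)).trans
          (mul_le_mul_of_nonneg_left (hδ t) hM0.le)⟩
  -- the two basic processes
  have radw : rad ρ w ≤ psi2 Ag F2 MX * E := by
    refine (rad_integral_kernel_le ρ κ BwW).trans (le_trans ?_
      (rad_dotProduct_le (fun i => κ i ∘ₘ ρ i) hp hx hM hδ hψ2))
    refine rad_le_of_abs_sub_le _ BwW (fun i => (BxW i).const_smul _) fun i z t t' => ?_
    refine ((hg i).abs_scoreInc_sub_le (hM i) θ j (δ t) (δ t') z).trans (le_of_eq ?_)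
    rw [← mul_sub, abs_mul, abs_of_nonneg hψ2]
  have radv : rad ρ v ≤ psi1 Ag F1 * E := by
    refine (rad_integral_kernel_le ρ κ BvW).trans (le_trans ?_
      (rad_dotProduct_le (fun i => κ i ∘ₘ ρ i) hp hx hM hδ hψ1))
    refine rad_le_of_abs_sub_le _ BvW (fun i => (BxW i).const_smul _) fun i z t t' => ?_
    refine ((hg i).abs_ratioInc_sub_le (x i) θ (δ t) (δ t') z).trans (le_of_eq ?_)
    rw [← mul_sub, abs_mul, abs_of_nonneg hψ1]
  -- their compositions with `rho`
  have radar : rad ρ (fun i y t => a i y * rho (v i y t)) ≤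
      psi1 Ag F1 * MX * rho1 Ag Bg * rad ρ v := by
    rw [← rad_smul _ (by positivity)]
    refine rad_le_of_abs_sub_le _ Bar (fun i => (Bv i).const_smul _) fun i y t t' => ?_
    simp only [Pi.smul_apply, smul_eq_mul]
    rw [← mul_sub, ← mul_sub, abs_mul, abs_mul,
      abs_of_nonneg (show 0 ≤ psi1 Ag F1 * MX * rho1 Ag Bg by positivity), mul_assoc _ (rho1 Ag Bg)]
    exact mul_le_mul (ha i y) (abs_rho_sub_rho_le hg0.pos hg0.lt (hv i y t) (hv i y t'))
      (abs_nonneg _) (by positivity)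
  have radwr : rad ρ (fun i y t => w i y t * rho (v i y t)) ≤
      2 * (rho0 Ag Bg * rad ρ w) + 2 * (psi3 Ag F1 F2 MX R * MX * rho1 Ag Bg * rad ρ v) := by
    have e1 : rho0 Ag Bg * rad ρ w = _ := (rad_smul ρ hρ0 w).symm
    have e2 : psi3 Ag F1 F2 MX R * MX * rho1 Ag Bg * rad ρ v = _ :=
      (rad_smul ρ (by positivity) v).symm
    rw [e1, e2]
    refine rad_le_of_abs_sub_le_add _ Bwr (fun i => (Bw i).const_smul _)
      (fun i => (Bv i).const_smul _) fun i y t t' => ?_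
    simp only [Pi.smul_apply, smul_eq_mul]
    rw [← mul_sub, ← mul_sub, abs_mul (rho0 Ag Bg), abs_of_nonneg hρ0,
      abs_mul (psi3 Ag F1 F2 MX R * MX * rho1 Ag Bg),
      abs_of_nonneg (show 0 ≤ psi3 Ag F1 F2 MX R * MX * rho1 Ag Bg by positivity)]
    have e : w i y t * rho (v i y t) - w i y t' * rho (v i y t') =
        rho (v i y t) * (w i y t - w i y t') + w i y t' * (rho (v i y t) - rho (v i y t')) := by
      ring
    rw [e]
    refine (abs_add_le _ _).trans (add_le_add ?_ ?_)
    · rw [abs_mul]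
      exact mul_le_mul_of_nonneg_right (hr i y t) (abs_nonneg _)
    · rw [abs_mul, mul_assoc _ (rho1 Ag Bg)]
      exact mul_le_mul (hw i y t') (abs_rho_sub_rho_le hg0.pos hg0.lt (hv i y t) (hv i y t'))
        (abs_nonneg _) (by positivity)
  have hsum : rad ρ (fun i y t => remainder (κ i) (g i) (x i) θ j (δ t) y) ≤ rad ρ w +
      (rad ρ (fun i y t => a i y * rho (v i y t)) + rad ρ fun i y t => w i y t * rho (v i y t)) :=
    (rad_add_le ρ Bw fun i => (Bar i).add (Bwr i)).trans
      (add_le_add le_rfl (rad_add_le ρ Bar Bwr))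
  have h1 := mul_le_mul_of_nonneg_left radv
    (show 0 ≤ psi1 Ag F1 * MX * rho1 Ag Bg by positivity)
  have h2 := mul_le_mul_of_nonneg_left radw hρ0
  have h3 := mul_le_mul_of_nonneg_left radv
    (show 0 ≤ psi3 Ag F1 F2 MX R * MX * rho1 Ag Bg by positivity)
  refine (hsum.trans (add_le_add radw (add_le_add (radar.trans h1) (radwr.trans
    (add_le_add (mul_le_mul_of_nonneg_left h2 zero_le_two)
      (mul_le_mul_of_nonneg_left h3 zero_le_two)))))).trans (le_of_eq ?_)
  ring

end RadRemainder

/-! ### Deviation of the centred log-ratio -/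

section Bound

variable {W 𝒴 : Type*} [MeasurableSpace W] [MeasurableSpace 𝒴]
  {n p : ℕ} {g : Fin n → ℝ → ℝ} {Ag Bg F1 F2 MX R : ℝ} {x : Fin n → W → Fin p → ℝ}
  (ρ : Fin n → Measure 𝒴) [∀ i, IsProbabilityMeasure (ρ i)]
  (κ : Fin n → Kernel 𝒴 W) [∀ i, IsMarkovKernel (κ i)]

omit [MeasurableSpace W] in
/-- The coefficient that the argument gives is at most the stated one, which has further nonnegative
terms. -/
theorem four_mul_coeff_le {g : ℝ → ℝ} {E l : ℝ} (hg : LinkBounds g Ag Bg F1 F2) (hM0 : 0 < MX)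
    (hR : 0 ≤ R) (hE : 0 ≤ E) :
    4 * ((psi2 Ag F2 MX * (1 + 2 * rho0 Ag Bg) +
        psi1 Ag F1 * MX * rho1 Ag Bg * (psi1 Ag F1 + 2 * psi3 Ag F1 F2 MX R)) *
      (R * √(2 * l) * E)) ≤
    2 * √2 * R * E * (coeffA Ag Bg F1 F2 MX R * √l + 2 * psi3 Ag F1 F2 MX R *
      (psi5 Ag Bg F1 MX + psi6 Ag Bg F1 F2 MX R)) := by
  have hψ1 := psi1_nonneg hg
  have hψ2 := psi2_nonneg hg hM0
  have hψ3 := psi3_nonneg hg hM0 hR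
  have hρ0 := rho0_nonneg (Ag := Ag) (Bg := Bg)
  have hρ1 := rho1_nonneg (Ag := Ag) (Bg := Bg)
  rw [Real.sqrt_mul zero_le_two, coeffA, psi5, psi6]
  set a := psi1 Ag F1
  set b := psi2 Ag F2 MX
  set c := psi3 Ag F1 F2 MX R
  set r := rho0 Ag Bg
  set s := rho1 Ag Bg
  have h1 : 2 * (b * (1 + 2 * r) + a * MX * s * (a + 2 * c)) ≤
      2 * b * (1 + 2 * (r + c * MX * s)) +
        (a + 2 * b * R + 2 * c) * (2 * a * MX * s + 2 * (r + c * MX * s)) := by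
    have : 0 ≤ 2 * b * (2 * (c * MX * s)) + a * (2 * (r + c * MX * s)) +
        2 * b * R * (2 * a * MX * s + 2 * (r + c * MX * s)) + 2 * c * (2 * (r + c * MX * s)) := by
      positivity
    linarith
  calc _ = 2 * √2 * R * E * (2 * (b * (1 + 2 * r) + a * MX * s * (a + 2 * c)) * √l) := by ring
    _ ≤ _ := by
      refine mul_le_mul_of_nonneg_left ?_ (by positivity)
      refine (mul_le_mul_of_nonneg_right h1 (Real.sqrt_nonneg l)).trans
        (le_add_of_nonneg_right (by positivity))

theorem sqrt_mul_mul_sqrt {a c l : ℝ} (ha : 0 ≤ a) (hc : 0 ≤ c) :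
    √a * (c * √l) = √(a * c ^ 2 * l) := by
  rw [Real.sqrt_mul (by positivity), Real.sqrt_mul ha, Real.sqrt_sq hc, mul_assoc]

/-- The sum over all observations of the log-ratio `ln (1 + condRatio)` minus its mean. -/
noncomputable def centredLog (ρ : Fin n → Measure 𝒴) (κ : Fin n → Kernel 𝒴 W) (g : Fin n → ℝ → ℝ)
    (x : Fin n → W → Fin p → ℝ) (θ δ : Fin p → ℝ) (y : Fin n → 𝒴) : ℝ :=
  ∑ i, (Real.log (1 + condRatio (κ i) (g i) (x i) θ δ (y i)) -
    ∫ r, Real.log (1 + condRatio (κ i) (g i) (x i) θ δ r) ∂ρ i)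

/-- The deviation of the linear part that is exceeded with probability at most `q`. -/
noncomputable def scoreBound (n p : ℕ) (Ag F1 MX q : ℝ) : ℝ :=
  √(2 * n) * (psi1 Ag F1 * MX * √(Real.log (2 * p / q)))

/-- The deviation of the remainders that is exceeded with probability at most `q`; here `E` stands
for the mean of `S_X`. -/
noncomputable def remainderBound (n p : ℕ) (Ag Bg F1 F2 MX R q E : ℝ) : ℝ :=
  2 * √2 * R * E * (coeffA Ag Bg F1 F2 MX R * √(Real.log (2 * p)) + 2 * psi3 Ag F1 F2 MX R *
      (psi5 Ag Bg F1 MX + psi6 Ag Bg F1 F2 MX R)) +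
    √(2 * n) * (2 * psi4 Ag Bg F1 F2 MX R * √(Real.log (p / q)))

/-- Hoeffding's inequality for each of the `p` coordinates at level `q / p`. -/
theorem measureReal_score_le (hn : 0 < n) (hp : 0 < p)
    (hg : ∀ i, LinkBounds (g i) Ag Bg F1 F2)
    (hx : ∀ i, Measurable (x i)) (hM : ∀ i z, ‖x i z‖ ≤ MX) (hM0 : 0 < MX) (θ : Fin p → ℝ)
    {q : ℝ} (hq : 0 < q) (hq1 : q ≤ 1) :
    (Measure.pi ρ).real {y | ∃ j, scoreBound n p Ag F1 MX q <
      |∑ i, (condScore (κ i) (g i) (x i) θ j (y i) -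
        ∫ r, condScore (κ i) (g i) (x i) θ j r ∂ρ i)|} ≤ q := by
  have hp' : (0 : ℝ) < p := by exact_mod_cast hp
  have hp1 : (1 : ℝ) ≤ p := by exact_mod_cast hp
  have hψ1 := psi1_nonneg (hg ⟨0, hn⟩)
  have e : scoreBound n p Ag F1 MX q =
      √(2 * n * (psi1 Ag F1 * MX) ^ 2 * Real.log (2 / (q / p))) := by
    rw [scoreBound, sqrt_mul_mul_sqrt (by positivity) (by positivity), div_div_eq_mul_div]
  have h := fun j => measureReal_abs_sum_sub_integral_lt_le ρ
    (fun i => (hg i).measurable_condScore (hx i) (κ i) θ j)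
    (fun i y => (hg i).abs_condScore_le (κ i) (hM i) θ j y) (q := q / p) (by positivity)
    ((div_le_one hp').2 (hq1.trans hp1))
  simp only [← e] at h
  rw [ofPred_exists]
  refine (measureReal_iUnion_fintype_le _).trans ((Finset.sum_le_sum fun j _ => h j).trans ?_)
  rw [Finset.sum_const, Finset.card_univ, Fintype.card_fin, nsmul_eq_mul,
    mul_div_cancel₀ _ hp'.ne']

/-- The uniform deviation bound for each of the `p` coordinates at level `q / p`. The index set `T`
is finite here; it contains a point with `δ = 0`, where the remainder vanishes. -/
theorem measureReal_remainder_le {T : Type*} [Fintype T] (hn : 0 < n) (hp : 0 < p)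
    (hg : ∀ i, LinkBounds (g i) Ag Bg F1 F2)
    (hx : ∀ i, Measurable (x i)) (hM : ∀ i z, ‖x i z‖ ≤ MX) (hM0 : 0 < MX) (θ : Fin p → ℝ)
    {δ : T → Fin p → ℝ} (hδ : ∀ t, l1norm (δ t) ≤ R) {t₀ : T} (ht₀ : δ t₀ = 0)
    {q : ℝ} (hq : 0 < q) (hq1 : q ≤ 1) :
    (Measure.pi ρ).real {y | ∃ j t, remainderBound n p Ag Bg F1 F2 MX R q
        (∫ z, maxColNorm (fun i => x i (z i)) ∂Measure.pi fun i => κ i ∘ₘ ρ i) <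
      |∑ i, (remainder (κ i) (g i) (x i) θ j (δ t) (y i) -
        ∫ r, remainder (κ i) (g i) (x i) θ j (δ t) r ∂ρ i)|} ≤ q := by
  have : Nonempty T := ⟨t₀⟩
  have hp' : (0 : ℝ) < p := by exact_mod_cast hp
  have hp1 : (1 : ℝ) ≤ p := by exact_mod_cast hp
  have hR : 0 ≤ R := (l1norm_nonneg _).trans (hδ t₀)
  have hg0 := hg ⟨0, hn⟩
  have hψ1 := psi1_nonneg hg0
  have hψ3 := psi3_nonneg hg0 hM0 hR
  have hρ0 := rho0_nonneg (Ag := Ag) (Bg := Bg)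
  have hψ4 : 0 ≤ psi4 Ag Bg F1 F2 MX R := by unfold psi4; positivity
  set E := ∫ z, maxColNorm (fun i => x i (z i)) ∂Measure.pi fun i => κ i ∘ₘ ρ i
  have hE : 0 ≤ E := integral_nonneg fun z => maxColNorm_nonneg _
  have e : √(2 * n) * (2 * psi4 Ag Bg F1 F2 MX R * √(Real.log (p / q))) =
      √(8 * n * (psi4 Ag Bg F1 F2 MX R) ^ 2 * Real.log (1 / (q / p))) := by
    rw [sqrt_mul_mul_sqrt (by positivity) (by positivity), one_div_div]
    congr 1
    ring
  have hB : ∀ j i, BddMeas fun y t => remainder (κ i) (g i) (x i) θ j (δ t) y := fun j i =>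
    ⟨measurable_pi_iff.2 fun t => (hg i).measurable_remainder (hx i) (κ i) θ j (δ t), _,
      fun y t => (hg i).abs_remainder_le (hx i) (κ i) (hM i) hM0 θ j (hδ t) y⟩
  have h := fun j => measureReal_exists_abs_sum_sub_integral_lt_le ρ (hB j)
    (fun i y t => (hg i).abs_remainder_le (hx i) (κ i) (hM i) hM0 θ j (hδ t) y) (t₀ := t₀)
    (fun i y => by rw [ht₀, (hg i).remainder_zero]) (q := q / p) (by positivity)
    ((div_le_one hp').2 (hq1.trans hp1))
  have hrad : ∀ j, 4 * rad ρ (fun i y t => remainder (κ i) (g i) (x i) θ j (δ t) y) +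
      √(8 * n * (psi4 Ag Bg F1 F2 MX R) ^ 2 * Real.log (1 / (q / p))) ≤
      remainderBound n p Ag Bg F1 F2 MX R q E := fun j => by
    rw [remainderBound, ← e]
    refine add_le_add (le_trans ?_ (four_mul_coeff_le hg0 hM0 hR hE)) le_rfl
    exact mul_le_mul_of_nonneg_left (rad_remainder_le ρ κ hn hp hg hx hM hM0 θ hδ j) (by norm_num)
  rw [ofPred_exists]
  refine (measureReal_iUnion_fintype_le _).trans ((Finset.sum_le_sum fun j _ => ?_).trans
    (le_of_eq (?_ : ∑ _j : Fin p, q / p = q)))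
  · refine (measureReal_mono fun y hy => ?_).trans (h j)
    obtain ⟨t, ht⟩ := hy
    exact ⟨t, (hrad j).trans_lt ht⟩
  · rw [Finset.sum_const, Finset.card_univ, Fintype.card_fin, nsmul_eq_mul,
      mul_div_cancel₀ _ hp'.ne']

theorem abs_centredLog_le (hg : ∀ i, LinkBounds (g i) Ag Bg F1 F2)
    (hx : ∀ i, Measurable (x i)) (hM : ∀ i z, ‖x i z‖ ≤ MX) (hM0 : 0 < MX) (θ δ : Fin p → ℝ)
    {b₁ b₂ : ℝ} {y : Fin n → 𝒴}
    (h₁ : ∀ j, |∑ i, (condScore (κ i) (g i) (x i) θ j (y i) -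
        ∫ r, condScore (κ i) (g i) (x i) θ j r ∂ρ i)| ≤ b₁)
    (h₂ : ∀ j, |∑ i, (remainder (κ i) (g i) (x i) θ j δ (y i) -
        ∫ r, remainder (κ i) (g i) (x i) θ j δ r ∂ρ i)| ≤ b₂) :
    |centredLog ρ κ g x θ δ y| ≤ (b₁ + b₂) * l1norm δ := by
  have e : centredLog ρ κ g x θ δ y = (fun j =>
      ∑ i, (condScore (κ i) (g i) (x i) θ j (y i) -
        ∫ r, condScore (κ i) (g i) (x i) θ j r ∂ρ i) +
      ∑ i, (remainder (κ i) (g i) (x i) θ j δ (y i) -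
        ∫ r, remainder (κ i) (g i) (x i) θ j δ r ∂ρ i)) ⬝ᵥ δ := by
    simp only [dotProduct, ← Finset.sum_add_distrib, Finset.sum_mul]
    rw [Finset.sum_comm]
    refine Finset.sum_congr rfl fun i _ => ?_
    have I1 : ∀ j, Integrable (condScore (κ i) (g i) (x i) θ j) (ρ i) := fun j =>
      Integrable.of_bound ((hg i).measurable_condScore (hx i) (κ i) θ j).aestronglyMeasurable _
        (ae_of_all _ fun r => (hg i).abs_condScore_le (κ i) (hM i) θ j r)
    have I2 : ∀ j, Integrable (remainder (κ i) (g i) (x i) θ j δ) (ρ i) := fun j =>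
      Integrable.of_bound ((hg i).measurable_remainder (hx i) (κ i) θ j δ).aestronglyMeasurable _
        (ae_of_all _ fun r => (hg i).abs_remainder_le (hx i) (κ i) (hM i) hM0 θ j le_rfl r)
    have I12 : ∀ j, Integrable (fun r => δ j * (condScore (κ i) (g i) (x i) θ j r +
        remainder (κ i) (g i) (x i) θ j δ r)) (ρ i) := fun j => ((I1 j).add (I2 j)).const_mul _
    simp only [(hg i).log_one_add_condRatio (hx i) (κ i) (hM i) hM0]
    rw [integral_finsetSum _ fun j _ => I12 j, ← Finset.sum_sub_distrib]
    refine Finset.sum_congr rfl fun j _ => ?_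
    rw [integral_const_mul, integral_add (I1 j) (I2 j)]
    ring
  rw [e]
  exact abs_dotProduct_le _ _ fun j => (abs_add_le _ _).trans (add_le_add (h₁ j) (h₂ j))

theorem continuous_centredLog (hg : ∀ i, LinkBounds (g i) Ag Bg F1 F2)
    (hx : ∀ i, Measurable (x i)) (θ : Fin p → ℝ) (y : Fin n → 𝒴) :
    Continuous fun δ => centredLog ρ κ g x θ δ y :=
  continuous_finsetSum _ fun i _ =>
    ((hg i).continuous_log_condRatio (hx i) (κ i) θ (y i)).sub
      ((hg i).continuous_integral_log_condRatio (hx i) (κ i) (ρ i) θ)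

/-- The uniform bound on all of `D`. The finite subsets in `measureReal_remainder_le` exhaust a
countable dense subset of `D`, and the failure events increase with them, so that continuity of the
measure along increasing unions keeps the level `q₁`. Continuity in `u` of both sides gives the
bound on `D`. -/
theorem exists_forall_abs_centredLog_le (hn : 0 < n) (hp : 0 < p)
    (hg : ∀ i, LinkBounds (g i) Ag Bg F1 F2)
    (hx : ∀ i, Measurable (x i)) (hM : ∀ i z, ‖x i z‖ ≤ MX) (hM0 : 0 < MX) (θ : Fin p → ℝ)
    {D : Set (Fin p → ℝ)} (hD : D.Nonempty) (hDR : ∀ u ∈ D, l1norm (u - θ) ≤ R)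
    {q₀ q₁ : ℝ} (hq₀ : 0 < q₀) (hq₁ : 0 < q₁) (hq : q₀ + q₁ < 1) :
    ∃ S : Set (Fin n → 𝒴), MeasurableSet S ∧ 1 - q₀ - q₁ ≤ (Measure.pi ρ).real S ∧
      ∀ y ∈ S, ∀ u ∈ D, |centredLog ρ κ g x θ (u - θ) y| ≤
        (scoreBound n p Ag F1 MX q₀ + remainderBound n p Ag Bg F1 F2 MX R q₁
          (∫ z, maxColNorm (fun i => x i (z i)) ∂Measure.pi fun i => κ i ∘ₘ ρ i)) *
        l1norm (u - θ) := by
  have : Nonempty D := hD.to_subtype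
  set b₁ := scoreBound n p Ag F1 MX q₀
  set b₂ := remainderBound n p Ag Bg F1 F2 MX R q₁
    (∫ z, maxColNorm (fun i => x i (z i)) ∂Measure.pi fun i => κ i ∘ₘ ρ i)
  let d : ℕ → D := TopologicalSpace.denseSeq D
  let sc : Fin p → (Fin n → 𝒴) → ℝ := fun j y =>
    |∑ i, (condScore (κ i) (g i) (x i) θ j (y i) - ∫ r, condScore (κ i) (g i) (x i) θ j r ∂ρ i)|
  let rm : Fin p → (Fin p → ℝ) → (Fin n → 𝒴) → ℝ := fun j δ y =>
    |∑ i, (remainder (κ i) (g i) (x i) θ j δ (y i) -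
      ∫ r, remainder (κ i) (g i) (x i) θ j δ r ∂ρ i)|
  have msc : ∀ j, Measurable (sc j) := fun j => by
    have := fun i => (hg i).measurable_condScore (hx i) (κ i) θ j
    fun_prop
  have mrm : ∀ j δ, Measurable (rm j δ) := fun j δ => by
    have := fun i => (hg i).measurable_remainder (hx i) (κ i) θ j δ
    fun_prop
  let B₁ : Set (Fin n → 𝒴) := {y | ∃ j, b₁ < sc j y}
  -- `none` is the index of the step `δ = 0`
  let B₂ : ℕ → Set (Fin n → 𝒴) := fun m => {y | ∃ j, ∃ t : Option (Fin m),
    b₂ < rm j (t.elim 0 fun k => d k - θ) y}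
  have mB₁ : MeasurableSet B₁ := by
    simp only [B₁, ofPred_exists]
    exact MeasurableSet.iUnion fun j => measurableSet_lt measurable_const (msc j)
  have mB₂ : ∀ m, MeasurableSet (B₂ m) := fun m => by
    simp only [B₂, ofPred_exists]
    exact MeasurableSet.iUnion fun j => MeasurableSet.iUnion fun t =>
      measurableSet_lt measurable_const (mrm j _)
  have h₁ : (Measure.pi ρ).real B₁ ≤ q₀ :=
    measureReal_score_le ρ κ hn hp hg hx hM hM0 θ hq₀ (by linarith)
  have h₂ : ∀ m, (Measure.pi ρ).real (B₂ m) ≤ q₁ := fun m =>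
    measureReal_remainder_le ρ κ (T := Option (Fin m)) hn hp hg hx hM hM0 θ
      (δ := fun t => t.elim 0 fun k => d k - θ)
      (by
        rintro (_ | k)
        · obtain ⟨u, hu⟩ := hD
          simpa [l1norm] using (l1norm_nonneg _).trans (hDR u hu)
        · exact hDR _ (d k).2) (t₀ := none) rfl hq₁ (by linarith)
  have mono : Monotone B₂ := by
    rintro m m' hm y ⟨j, t, ht⟩
    refine ⟨j, t.map (Fin.castLE hm), ?_⟩
    cases t <;> exact ht
  have h₂' : (Measure.pi ρ).real (⋃ m, B₂ m) ≤ q₁ := by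
    rw [measureReal_def, mono.measure_iUnion]
    refine ENNReal.toReal_le_of_le_ofReal hq₁.le (iSup_le fun m => ?_)
    exact (ENNReal.le_ofReal_iff_toReal_le (measure_ne_top _ _) hq₁.le).2 (h₂ m)
  refine ⟨(B₁ ∪ ⋃ m, B₂ m)ᶜ, (mB₁.union (MeasurableSet.iUnion mB₂)).compl, ?_, ?_⟩
  · rw [probReal_compl_eq_one_sub (mB₁.union (MeasurableSet.iUnion mB₂))]
    have := measureReal_union_le (μ := Measure.pi ρ) B₁ (⋃ m, B₂ m)
    linarith
  · intro y hy u hu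
    simp only [compl_union, mem_inter_iff, mem_compl_iff, mem_iUnion, not_exists] at hy
    have hsc : ∀ j, sc j y ≤ b₁ := fun j => not_lt.1 fun h => hy.1 ⟨j, h⟩
    have hrm : ∀ k j, rm j (d k - θ) y ≤ b₂ := fun k j => not_lt.1 fun h =>
      hy.2 (k + 1) ⟨j, some (Fin.last k), h⟩
    let C : Set D := {u | |centredLog ρ κ g x θ ((u : Fin p → ℝ) - θ) y| ≤
      (b₁ + b₂) * l1norm ((u : Fin p → ℝ) - θ)}
    have hC : IsClosed C := by
      refine isClosed_le ?_ ?_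
      · have h := continuous_centredLog ρ κ hg hx θ y
        have h' : Continuous fun u : D => (u : Fin p → ℝ) - θ := by fun_prop
        exact (h.comp h').abs
      · unfold l1norm
        fun_prop
    have hd : ∀ k, d k ∈ C := fun k => by
      have h := abs_centredLog_le ρ κ hg hx hM hM0 θ ((d k : Fin p → ℝ) - θ) (b₁ := b₁) (b₂ := b₂)
        (y := y) hsc (hrm k)
      exact h
    have hdense : (⟨u, hu⟩ : D) ∈ closure (range d) := TopologicalSpace.denseRange_denseSeq D _
    have hsub : range d ⊆ C := range_subset_iff.2 hd
    have hmem : (⟨u, hu⟩ : D) ∈ C := closure_minimal hsub hC hdense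
    exact hmem

end Bound

/-! ### The posterior law of the hidden variable -/

section Posterior

variable {W 𝒴 : Type*} [MeasurableSpace W] [MeasurableSpace 𝒴] {p : ℕ}

theorem integral_withDensity_ofReal_div {μ : Measure W} {f : W → ℝ} (hf : Measurable f)
    (hf0 : ∀ z, 0 ≤ f z) {c : ℝ≥0∞} (hc : c ≠ 0) (r : W → ℝ) :
    ∫ z, r z ∂μ.withDensity (fun z => ENNReal.ofReal (f z) / c) =
      ∫ z, f z / c.toReal * r z ∂μ := by
  rw [integral_withDensity_eq_integral_toReal_smul (hf.ennreal_ofReal.div_const c)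
    (ae_of_all _ fun z => ENNReal.div_lt_top ENNReal.ofReal_ne_top hc)]
  congr 1 with z
  rw [ENNReal.toReal_div, ENNReal.toReal_ofReal (hf0 _), smul_eq_mul]

/-- The posterior law of the hidden variable: its density with respect to `μ` is proportional to `z
↦ g(x(z)ᵀθ) k(z, y)`. Mixing it over the observations gives back the law of the hidden variable, and
integrals against `k(·, y) μ` become posterior means, up to a factor that does not depend on `u`. -/
theorem exists_posterior {μ : Measure W} {ν : Measure 𝒴} [SFinite μ] [SFinite ν] {g : ℝ → ℝ}
    (hgm : Measurable g) (hg : ∀ t, 0 < g t) {k : W → 𝒴 → ℝ}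
    (hk : Measurable (Function.uncurry k)) (hk0 : ∀ z y, 0 ≤ k z y) {x : W → Fin p → ℝ}
    (hx : Measurable x) (θ : Fin p → ℝ) {Q : Measure (W × 𝒴)} [IsProbabilityMeasure Q]
    (hQ : Q = (μ.prod ν).withDensity fun s => ENNReal.ofReal (jointDensity μ ν g k x θ s)) :
    ∃ κ : Kernel 𝒴 W, IsMarkovKernel κ ∧ κ ∘ₘ Q.snd = Q.fst ∧
      ∀ᵐ y ∂Q.snd, ∃ c : ℝ, 0 < c ∧ ∀ u, ∫ z, g (x z ⬝ᵥ u) * k z y ∂μ =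
        c * ∫ z, g (x z ⬝ᵥ u) / g (x z ⬝ᵥ θ) ∂κ y := by
  classical
  obtain ⟨z₀⟩ : Nonempty W := (nonempty_of_isProbabilityMeasure Q).map Prod.fst
  have mdot : ∀ u, Measurable fun z => x z ⬝ᵥ u := fun u => by unfold dotProduct; fun_prop
  set Z := normConst μ ν g k x θ
  let f : W × 𝒴 → ℝ := fun s => g (x s.1 ⬝ᵥ θ) * k s.1 s.2
  have hf0 : ∀ s, 0 ≤ f s := fun s => mul_nonneg (hg _).le (hk0 _ _)
  have mf : Measurable f := ((hgm.comp (mdot θ)).comp measurable_fst).mul hk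
  let φ : 𝒴 → W → ℝ≥0∞ := fun y z => ENNReal.ofReal (f (z, y))
  have mφ : Measurable (Function.uncurry φ) := (mf.comp measurable_swap).ennreal_ofReal
  let c : 𝒴 → ℝ≥0∞ := fun y => ∫⁻ z, φ y z ∂μ
  have mc : Measurable c := mφ.lintegral_prod_right
  have hZ0 : 0 ≤ Z := integral_nonneg hf0
  -- a vanishing normalizing constant would make the density, hence the law, vanish
  have hZ : 0 < Z := by
    refine lt_of_le_of_ne hZ0 fun h => ?_
    have : Q = 0 := by
      rw [hQ]
      simp only [jointDensity]
      rw [show normConst μ ν g k x θ = 0 from h.symm]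
      simp
    exact IsProbabilityMeasure.ne_zero Q this
  have hdens : ∀ s : W × 𝒴, ENNReal.ofReal (jointDensity μ ν g k x θ s) =
      φ s.2 s.1 / ENNReal.ofReal Z := fun s => ENNReal.ofReal_div_of_pos hZ
  have mdens : Measurable fun s : W × 𝒴 => φ s.2 s.1 / ENNReal.ofReal Z :=
    (mφ.comp measurable_swap).div_const _
  simp only [hdens] at hQ
  -- the mass of a rectangle
  have hrect : ∀ {A : Set W} {B : Set 𝒴}, MeasurableSet A → MeasurableSet B →
      Q (A ×ˢ B) = ∫⁻ y in B, (∫⁻ z in A, φ y z ∂μ) / ENNReal.ofReal Z ∂ν := by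
    intro A B hA hB
    rw [hQ, withDensity_apply _ (hA.prod hB), ← Measure.prod_restrict,
      lintegral_prod_symm _ mdens.aemeasurable]
    refine lintegral_congr fun y => ?_
    simp only [div_eq_mul_inv]
    exact lintegral_mul_const _ (mφ.comp measurable_prodMk_left)
  have hsnd : Q.snd = ν.withDensity fun y => c y / ENNReal.ofReal Z := by
    ext B hB
    rw [Measure.snd_apply hB, withDensity_apply _ hB, ← univ_prod, hrect .univ hB]
    simp [c]
  have hcfin : ∀ᵐ y ∂ν, c y ≠ ∞ := by
    have h1 : ∫⁻ y, c y / ENNReal.ofReal Z ∂ν = 1 := by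
      have := hrect (A := univ) (B := univ) .univ .univ
      rw [univ_prod_univ, measure_univ] at this
      simpa [c] using this.symm
    filter_upwards [ae_lt_top (mc.div_const _) (by rw [h1]; simp)] with y hy h
    rw [h, ENNReal.top_div_of_ne_top ENNReal.ofReal_ne_top] at hy
    exact lt_irrefl _ hy
  have hc0 : ∀ᵐ y ∂Q.snd, c y ≠ 0 := by
    rw [hsnd, ae_withDensity_iff (mc.div_const _)]
    exact ae_of_all _ fun y hy h => hy (by simp [h])
  have hcfin' : ∀ᵐ y ∂Q.snd, c y ≠ ∞ := by
    rw [hsnd]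
    exact (withDensity_absolutelyContinuous _ _).ae_le hcfin
  let κ₀ : Kernel 𝒴 W := Kernel.withDensity (Kernel.const 𝒴 μ) fun y z => φ y z / c y
  have mφc : Measurable (Function.uncurry fun y z => φ y z / c y) :=
    mφ.div (mc.comp measurable_fst)
  have hκ₀ : ∀ y, κ₀ y = μ.withDensity fun z => φ y z / c y := fun y => by
    rw [Kernel.withDensity_apply _ mφc, Kernel.const_apply]
  have hκ₀A : ∀ y {A : Set W}, MeasurableSet A → κ₀ y A = (∫⁻ z in A, φ y z ∂μ) / c y := by
    intro y A hA
    rw [hκ₀, withDensity_apply _ hA]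
    simp only [div_eq_mul_inv]
    exact lintegral_mul_const _ (mφ.comp measurable_prodMk_left)
  have hs : MeasurableSet {y | c y ≠ 0 ∧ c y ≠ ∞} :=
    (mc (measurableSet_singleton 0).compl).inter (mc (measurableSet_singleton ∞).compl)
  -- where the normalization fails, which has probability zero, any probability measure will do
  let κ : Kernel 𝒴 W := Kernel.piecewise hs κ₀ (Kernel.const 𝒴 (Measure.dirac z₀))
  have hκ : ∀ y, c y ≠ 0 → c y ≠ ∞ → κ y = κ₀ y := fun y h h' => by
    simp only [κ, Kernel.piecewise_apply]
    exact if_pos ⟨h, h'⟩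
  have hmarkov : IsMarkovKernel κ := ⟨fun y => by
    by_cases h : c y ≠ 0 ∧ c y ≠ ∞
    · rw [hκ y h.1 h.2]
      refine ⟨?_⟩
      rw [hκ₀A y .univ, Measure.restrict_univ]
      exact ENNReal.div_self h.1 h.2
    · have : κ y = Measure.dirac z₀ := by
        simp only [κ, Kernel.piecewise_apply]
        exact if_neg h
      rw [this]
      infer_instance⟩
  refine ⟨κ, hmarkov, ?_, ?_⟩
  · ext A hA
    rw [Measure.bind_apply hA κ.aemeasurable, Measure.fst_apply hA, ← prod_univ, hrect hA .univ,
      Measure.restrict_univ]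
    calc ∫⁻ y, κ y A ∂Q.snd = ∫⁻ y, κ₀ y A ∂Q.snd := by
          refine lintegral_congr_ae ?_
          filter_upwards [hc0, hcfin'] with y h h'
          rw [hκ y h h']
      _ = ∫⁻ y, (c y / ENNReal.ofReal Z) * κ₀ y A ∂ν := by
          rw [hsnd, lintegral_withDensity_eq_lintegral_mul _ (mc.div_const _)
            (Kernel.measurable_coe κ₀ hA)]
          rfl
      _ = _ := by
          refine lintegral_congr_ae ?_
          filter_upwards [hcfin] with y h
          rw [hκ₀A y hA]
          by_cases h0 : c y = 0
          · have : ∫⁻ z in A, φ y z ∂μ = 0 :=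
              le_antisymm ((setLIntegral_le_lintegral A _).trans h0.le) (zero_le)
            simp [h0, this]
          · rw [div_eq_mul_inv, div_eq_mul_inv, div_eq_mul_inv]
            calc c y * (ENNReal.ofReal Z)⁻¹ * ((∫⁻ z in A, φ y z ∂μ) * (c y)⁻¹)
                = (c y * (c y)⁻¹) * ((∫⁻ z in A, φ y z ∂μ) * (ENNReal.ofReal Z)⁻¹) := by ring
              _ = _ := by rw [ENNReal.mul_inv_cancel h0 h, one_mul]
  · filter_upwards [hc0, hcfin'] with y h h'
    have hpos : 0 < (c y).toReal := ENNReal.toReal_pos h h'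
    refine ⟨(c y).toReal, hpos, fun u => ?_⟩
    have halg : ∀ {a b k C : ℝ}, a ≠ 0 → C ≠ 0 → b * k = C * (a * k / C * (b / a)) := by
      intro a b k C ha hC
      field_simp
    have hy : Measurable fun z => f (z, y) := mf.comp measurable_prodMk_right
    rw [hκ y h h', hκ₀, integral_withDensity_ofReal_div hy (fun z => hf0 (z, y)) h,
      ← integral_const_mul]
    exact integral_congr_ae (ae_of_all _ fun z => halg (hg (x z ⬝ᵥ θ)).ne' hpos.ne')

end Posterior

/-! ### The search domain and the theorem -/

section Geometry

variable {p : ℕ}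

theorem l1norm_le_card_mul_norm (v : Fin p → ℝ) : l1norm v ≤ p * ‖v‖ := by
  refine (Finset.sum_le_sum fun j _ => norm_le_pi_norm v j).trans ?_
  simp

theorem l1norm_pos {v : Fin p → ℝ} (hv : v ≠ 0) : 0 < l1norm v := by
  obtain ⟨j, hj⟩ := Function.ne_iff.1 hv
  exact Finset.sum_pos' (fun _ _ => abs_nonneg _) ⟨j, Finset.mem_univ j, abs_pos.2 hj⟩

theorem l1norm_sub_le_radius {D : Set (Fin p → ℝ)} (hD : Bornology.IsBounded D)
    (θ : Fin p → ℝ) {u : Fin p → ℝ} (hu : u ∈ D) : l1norm (u - θ) ≤ radius D θ := by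
  obtain ⟨r, hr⟩ := hD.subset_closedBall θ
  refine le_csSup ⟨p * r, ?_⟩ ⟨u, hu, rfl⟩
  rintro _ ⟨v, hv, rfl⟩
  refine (l1norm_le_card_mul_norm _).trans (mul_le_mul_of_nonneg_left ?_ p.cast_nonneg)
  simpa [dist_eq_norm] using hr hv

/-- The covariate vector, replaced by `0` where its norm exceeds `M`. -/
noncomputable def truncate {W : Type*} (M : ℝ) (x : W → Fin p → ℝ) (z : W) : Fin p → ℝ :=
  if ‖x z‖ ≤ M then x z else 0

theorem measurable_truncate {W : Type*} [MeasurableSpace W] {M : ℝ} {x : W → Fin p → ℝ}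
    (hx : Measurable x) : Measurable (truncate M x) :=
  Measurable.ite (measurableSet_le hx.norm measurable_const) hx measurable_const

theorem norm_truncate_le {W : Type*} {M : ℝ} (hM : 0 ≤ M) (x : W → Fin p → ℝ) (z : W) :
    ‖truncate M x z‖ ≤ M := by
  unfold truncate
  split_ifs with h
  · exact h
  · simpa using hM

end Geometry

end HiddenCovariate

open HiddenCovariate in
theorem theorem5
    {Ω W 𝒴 : Type*} [MeasurableSpace Ω] [MeasurableSpace W] [MeasurableSpace 𝒴]
    (P : Measure Ω) [IsProbabilityMeasure P] {N p : ℕ}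
    -- the hidden variables and the observations
    (hid : Fin N → Ω → W) (Y : Fin N → Ω → 𝒴)
    (hhid : ∀ i, Measurable (hid i)) (hY : ∀ i, Measurable (Y i))
    (hindep : iIndepFun (fun i w => (hid i w, Y i w)) P)
    -- the model: the pair (hid i, Y i) has a density with respect to μ i × ν i
    (μ : Fin N → Measure W) (ν : Fin N → Measure 𝒴)
    [∀ i, SFinite (μ i)] [∀ i, SFinite (ν i)]
    (g : Fin N → ℝ → ℝ) (k : Fin N → W → 𝒴 → ℝ) (x : Fin N → W → Fin p → ℝ)
    (hk : ∀ i, Measurable (Function.uncurry (k i))) (hk0 : ∀ i z y, 0 ≤ k i z y)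
    (hx : ∀ i, Measurable (x i))
    (θ : Fin p → ℝ)
    (hlaw : ∀ i, P.map (fun w => (hid i w, Y i w)) =
      ((μ i).prod (ν i)).withDensity (fun s =>
        ENNReal.ofReal (HiddenCovariate.jointDensity (μ i) (ν i) (g i) (k i) (x i) θ s)))
    -- the search domain
    (D : Set (Fin p → ℝ)) (hD : Bornology.IsBounded D) (hθ : θ ∈ D)
    -- the assumption on the covariates (the norm of `Fin p → ℝ` is the sup norm) and on the `g i`
    (MX Ag Bg F1 F2 : ℝ) (hMX : 0 < MX) (hxMX : ∀ᵐ w ∂P, ∀ i, ‖x i (hid i w)‖ ≤ MX)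
    (hAg : 0 < Ag) (hAB : Ag < Bg)
    (hg : ∀ i, Differentiable ℝ (g i))
    (hgAB : ∀ i t, Ag ≤ g i t ∧ g i t ≤ Bg)
    (hgF1 : ∀ i t, |deriv (g i) t| ≤ F1)
    (hgF2 : ∀ i s t, |deriv (g i) t - deriv (g i) s| ≤ F2 * |t - s|)
    (q0 q1 : ℝ) (hq0 : 0 < q0) (hq1 : 0 < q1) (hq : q0 + q1 < 1) :
    let L : (Fin p → ℝ) → Ω → ℝ := fun u w =>
      HiddenCovariate.negLogLik μ ν g k x u (fun i => Y i w)
    let SX : Ω → ℝ := fun w => HiddenCovariate.maxColNorm (fun i => x i (hid i w))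
    let R : ℝ := HiddenCovariate.radius D θ
    let ψ1 : ℝ := HiddenCovariate.psi1 Ag F1
    let ψ3 : ℝ := HiddenCovariate.psi3 Ag F1 F2 MX R
    let ψ4 : ℝ := HiddenCovariate.psi4 Ag Bg F1 F2 MX R
    let ψ5 : ℝ := HiddenCovariate.psi5 Ag Bg F1 MX
    let ψ6 : ℝ := HiddenCovariate.psi6 Ag Bg F1 F2 MX R
    let A : ℝ := HiddenCovariate.coeffA Ag Bg F1 F2 MX R
    -- the two expectations in the bound exist
    (∀ u ∈ D, Integrable (fun w => L u w - L θ w) P) ∧ Integrable SX P ∧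
    -- with probability at least `1 - q0 - q1`, the local Lipschitz coefficient is bounded
    ∃ E : Set Ω, MeasurableSet E ∧ 1 - q0 - q1 ≤ P.real E ∧ ∀ w ∈ E,
      (⨆ u ∈ D \ {θ}, ENNReal.ofReal
          (|(L u w - L θ w) - ∫ w', (L u w' - L θ w') ∂P| / HiddenCovariate.l1norm (u - θ)))
        ≤ ENNReal.ofReal
          (2 * √2 * R * (∫ w, SX w ∂P) * (A * √(Real.log (2 * p)) + 2 * ψ3 * (ψ5 + ψ6))
            + √(2 * N) * (ψ1 * MX * √(Real.log (2 * p / q0))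
              + 2 * ψ4 * √(Real.log (p / q1)))) := by
  intro L SX R ψ1 ψ3 ψ4 ψ5 ψ6 A
  have hlb : ∀ i, LinkBounds (g i) Ag Bg F1 F2 := fun i =>
    ⟨hAg, hAB, hg i, hgAB i, hgF1 i, hgF2 i⟩
  have hpair : ∀ i, Measurable fun w => (hid i w, Y i w) := fun i => (hhid i).prodMk (hY i)
  have hprob : ∀ i, IsProbabilityMeasure (P.map fun w => (hid i w, Y i w)) := fun i =>
    Measure.isProbabilityMeasure_map (hpair i).aemeasurable
  choose κ hκM hκ hκc using fun i => exists_posterior (hg i).continuous.measurable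
    (hlb i).g_pos (hk i) (hk0 i) (hx i) θ (hlaw i)
  let ρ : Fin N → Measure 𝒴 := fun i => P.map (Y i)
  have hρ : ∀ i, IsProbabilityMeasure (ρ i) := fun i =>
    Measure.isProbabilityMeasure_map (hY i).aemeasurable
  have hsnd : ∀ i, (P.map fun w => (hid i w, Y i w)).snd = ρ i := fun i =>
    Measure.snd_map_prodMk (hhid i)
  have hfst : ∀ i, (P.map fun w => (hid i w, Y i w)).fst = P.map (hid i) := fun i =>
    Measure.fst_map_prodMk (hY i)
  simp only [hsnd, hfst] at hκ hκc
  -- covariates that are bounded everywhere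
  let x' : Fin N → W → Fin p → ℝ := fun i => truncate MX (x i)
  have hx' : ∀ i, Measurable (x' i) := fun i => measurable_truncate (hx i)
  have hM' : ∀ i z, ‖x' i z‖ ≤ MX := fun i z => norm_truncate_le hMX.le (x i) z
  have hxx' : ∀ᵐ w ∂P, ∀ i, x' i (hid i w) = x i (hid i w) := by
    filter_upwards [hxMX] with w hw i
    exact if_pos (hw i)
  -- the exceptional null set of hidden points is also null for almost every posterior law
  have hκx : ∀ i, ∀ᵐ y ∂ρ i, ∀ᵐ z ∂κ i y, x' i z = x i z := fun i => by
    refine Measure.ae_ae_of_ae_comp (p := fun z => x' i z = x i z) ?_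
    rw [hκ i, ae_map_iff (hhid i).aemeasurable (measurableSet_eq_fun (hx' i) (hx i))]
    filter_upwards [hxx'] with w hw using hw i
  -- the log-likelihood in terms of the posterior means of the density ratios
  let C : (Fin p → ℝ) → ℝ := fun u => ∑ i, Real.log (normConst (μ i) (ν i) (g i) (k i) (x i) u) -
    ∑ i, Real.log (normConst (μ i) (ν i) (g i) (k i) (x i) θ)
  let lr : Fin N → (Fin p → ℝ) → 𝒴 → ℝ := fun i u y =>
    Real.log (1 + condRatio (κ i) (g i) (x' i) θ (u - θ) y)
  have hlog : ∀ i, ∀ᵐ y ∂ρ i, ∀ u, Real.log (∫ z, g i (x i z ⬝ᵥ u) * k i z y ∂μ i) -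
      Real.log (∫ z, g i (x i z ⬝ᵥ θ) * k i z y ∂μ i) = lr i u y := by
    intro i
    filter_upwards [hκc i, hκx i] with y ⟨c, hc, hcu⟩ hy u
    have hV : ∀ u, ∫ z, g i (x i z ⬝ᵥ u) / g i (x i z ⬝ᵥ θ) ∂κ i y =
        1 + condRatio (κ i) (g i) (x' i) θ (u - θ) y := by
      intro u
      rw [(hlb i).one_add_condRatio_eq (hx' i), add_sub_cancel]
      refine integral_congr_ae ?_
      filter_upwards [hy] with z hz
      rw [hz]
    have hpos := fun u => (hlb i).one_add_condRatio_pos (hx' i) (κ i) θ (u - θ) y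
    rw [hcu, hcu, hV, hV, Real.log_mul hc.ne' (hpos u).ne', Real.log_mul hc.ne' (hpos θ).ne',
      sub_self θ, (hlb i).condRatio_zero]
    simp [lr]
  have hLae : ∀ᵐ w ∂P, ∀ u, L u w - L θ w = C u - ∑ i, lr i u (Y i w) := by
    have := ae_all_iff.2 fun i => ae_of_ae_map (hY i).aemeasurable (hlog i)
    filter_upwards [this] with w hw u
    simp only [L, negLogLik, C, ← hw, Finset.sum_sub_distrib]
    ring
  have mlr : ∀ i u, Measurable (lr i u) := fun i u => by
    have := (hlb i).measurable_condRatio (hx' i) (κ i) θ (u - θ)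
    fun_prop
  have Ilr : ∀ i u, Integrable (lr i u) (ρ i) := fun i u =>
    Integrable.of_bound (mlr i u).aestronglyMeasurable _
      (ae_of_all _ fun y => (hlb i).abs_log_condRatio_le (hx' i) (κ i) θ (u - θ) y)
  have IlrP : ∀ i u, Integrable (fun w => lr i u (Y i w)) P := fun i u =>
    (Ilr i u).comp_measurable (hY i)
  have hLI : ∀ u, Integrable (fun w => L u w - L θ w) P := fun u => by
    have I : Integrable (fun w => C u - ∑ i, lr i u (Y i w)) P :=
      (integrable_const _).sub (integrable_finsetSum Finset.univ fun i _ => IlrP i u)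
    refine I.congr ?_
    filter_upwards [hLae] with w hw using (hw u).symm
  have hLmean : ∀ u, ∫ w, (L u w - L θ w) ∂P = C u - ∑ i, ∫ y, lr i u y ∂ρ i := fun u => by
    rw [integral_congr_ae (g := fun w => C u - ∑ i, lr i u (Y i w))
      (by filter_upwards [hLae] with w hw using hw u),
      integral_sub (integrable_const _) (integrable_finsetSum Finset.univ fun i _ => IlrP i u),
      integral_finsetSum Finset.univ fun i _ => IlrP i u]
    simp only [integral_const, probReal_univ, one_smul, ρ]
    congr 1
    refine Finset.sum_congr rfl fun i _ => ?_
    rw [integral_map (hY i).aemeasurable (mlr i u).aestronglyMeasurable]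
  have hcent : ∀ᵐ w ∂P, ∀ u, |(L u w - L θ w) - ∫ w', (L u w' - L θ w') ∂P| =
      |centredLog ρ κ g x' θ (u - θ) (fun i => Y i w)| := by
    filter_upwards [hLae] with w hw u
    rw [hw, hLmean, ← abs_neg, centredLog, Finset.sum_sub_distrib]
    congr 1
    simp only [lr]
    ring
  have hSXae : SX =ᵐ[P] fun w => maxColNorm fun i => x' i (hid i w) := by
    filter_upwards [hxx'] with w hw
    simp only [SX, hw]
  have mX : Measurable fun z : Fin N → W => maxColNorm fun i => x' i (z i) :=
    measurable_maxColNorm.comp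
      (measurable_pi_iff.2 fun i => (hx' i).comp (measurable_pi_apply i))
  have mhid : Measurable fun w i => hid i w := measurable_pi_iff.2 hhid
  have mY : Measurable fun w i => Y i w := measurable_pi_iff.2 hY
  have hSXI : Integrable SX P := by
    refine Integrable.congr (Integrable.of_bound (mX.comp mhid).aestronglyMeasurable
      (√(N * MX ^ 2)) (ae_of_all _ fun w => ?_)) hSXae.symm
    rw [Function.comp_apply, Real.norm_of_nonneg (maxColNorm_nonneg _)]
    exact maxColNorm_le fun i => hM' i _
  refine ⟨fun u _ => hLI u, hSXI, ?_⟩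
  -- without observations or without parameters, the left-hand side vanishes
  rcases Nat.eq_zero_or_pos N with rfl | hN
  · refine ⟨univ, .univ, by simp; linarith, fun w _ => iSup₂_le fun u _ => ?_⟩
    simp [L, negLogLik]
  rcases Nat.eq_zero_or_pos p with rfl | hp
  · refine ⟨univ, .univ, by simp; linarith, fun w _ => iSup₂_le fun u hu => ?_⟩
    exact absurd (Subsingleton.elim u θ) hu.2
  have hYlaw : P.map (fun w i => Y i w) = Measure.pi ρ :=
    (iIndepFun_iff_map_fun_eq_pi_map fun i => (hY i).aemeasurable).1
      (hindep.comp (fun _ => Prod.snd) fun _ => measurable_snd)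
  have hhidlaw : P.map (fun w i => hid i w) = Measure.pi fun i => κ i ∘ₘ ρ i := by
    simp only [hκ]
    exact (iIndepFun_iff_map_fun_eq_pi_map fun i => (hhid i).aemeasurable).1
      (hindep.comp (fun _ => Prod.fst) fun _ => measurable_fst)
  have hSXmean : ∫ z, maxColNorm (fun i => x' i (z i)) ∂Measure.pi (fun i => κ i ∘ₘ ρ i) =
      ∫ w, SX w ∂P := by
    rw [← hhidlaw, integral_map mhid.aemeasurable mX.aestronglyMeasurable,
      integral_congr_ae hSXae]
  obtain ⟨S, mS, hS, hSb⟩ := exists_forall_abs_centredLog_le ρ κ hN hp hlb hx' hM' hMX θ ⟨θ, hθ⟩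
    (fun u hu => l1norm_sub_le_radius hD θ hu) hq0 hq1 hq
  -- the set where `hcent` holds need not be measurable; `G` is a measurable subset of full measure
  obtain ⟨G, hG, mG, hGc⟩ := hcent.exists_measurable_mem
  refine ⟨(fun w i => Y i w) ⁻¹' S ∩ G, (mY mS).inter mG, ?_, ?_⟩
  · rw [measureReal_congr (inter_ae_eq_left_of_ae_eq_univ (ae_eq_univ.2 (mem_ae_iff.1 hG))),
      ← map_measureReal_apply mY mS, hYlaw]
    exact hS
  · rintro w ⟨hwS, hwG⟩
    refine iSup₂_le fun u hu => ENNReal.ofReal_le_ofReal ?_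
    rw [div_le_iff₀ (l1norm_pos (sub_ne_zero.2 hu.2)), hGc w hwG u]
    refine (hSb _ hwS u hu.1).trans (le_of_eq ?_)
    rw [hSXmean, scoreBound, remainderBound]
    simp only [A, ψ1, ψ3, ψ4, ψ5, ψ6, R]
    ring
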